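/- Let $\theta>0$ and let $Y^\infty=(Y_1,Y_2,\dots)$ be an enumeration of the points of a Poisson point process on $(0,\infty)$ with intensity $\theta y^{-1}e^{-y}\,dy$. Let $\ddot Y^\infty=(\ddot Y_1,\ddot Y_2,\dots)$ be its size-biased random rearrangement: given $Y^\infty$, for every $k$ and all distinct indices $i_1,\dots,i_k$, $$\mathbb P\big(\ddot Y_1=Y_{i_1},\dots,\ddot Y_k=Y_{i_k}\mid Y^\infty\big)=\prod_{j=1}^{k}\frac{Y_{i_j}}{|Y^\infty|-\sum_{l<j}Y_{i_l}},\qquad |Y^\infty|=\sum_i Y_i ,$$ and let $\ddot\gamma_\theta$ be the law of $\ddot Y^\infty$ on $\mathbb R^{\mathbb N}$. For $a>0$ and $m\in\mathbb N=\{0,1,\dots\}$ let $L_m^{a}(z)=\frac{(a)_m}{m!}\,{}_1F_1(-m;a;z)$ be the Laguerre polynomial orthogonal with respect to the Gamma$(a)$ density, and for $\alpha,\beta>0$ let $R_k^{(\alpha,\beta)}(x)={}_2F_1(-k,k+\alpha+\beta-1;\beta;1-x)$ be the shifted Jacobi polynomial orthogonal with respect to the Beta$(\alpha,\beta)$ distribution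 on $[0,1]$, with $R_k^{(\alpha,\beta)}(1)=1$. For $n\in\mathbb N^\infty$ with $|n|=\sum_j n_j<\infty$ put $N_j=\sum_{i>j}n_i$ and $$\ddot R_n^{\theta}(x)=\prod_{j=1}^{\infty}R_{n_j}^{(1,\theta+2N_j)}\Big(\frac{x_j}{1-s_{j-1}}\Big)(1-s_{j-1})^{n_j},\qquad s_{j-1}=\sum_{i<j}x_i .$$ For $m\in\mathbb N$ and $n\in\mathbb N^\infty$ with $|n|<\infty$ define, with $|y|=\sum_i y_i$, $$L^{\theta *}_{(m,n)}(y)=L_m^{\theta+2|n|}(|y|)\,|y|^{|n|}\,\ddot R_n^{\theta}\Big(\frac{y}{|y|}\Big).$$ Then on the summable sequences $y$ with positive terms each $L^{\theta *}_{(m,n)}$ is a polynomial of total degree $m+|n|$ in $|y|$ and finitely many of the coordinates $y_j$, and these functions form an orthogonal system with respect to $\ddot\gamma_\theta$: all of them lie in $L^2(\ddot\gamma_\theta)$, none has norm zero, and $$\int L^{\theta *}_{(m,n)}\,L^{\theta *}_{(m',n')}\,d\ddot\gamma_\theta=0\qquad\text{whenever }(m,n)\neq(m',n').$$ -/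

import Mathlib

open MeasureTheory ProbabilityTheory Polynomial
open scoped ENNReal NNReal

namespace GammaLaguerre

noncomputable section

/-! ### Classical orthogonal polynomials -/

/-- The rising factorial `a (a + 1) ⋯ (a + k - 1)`. -/
def rising (a : ℝ) (k : ℕ) : ℝ := (ascPochhammer ℝ k).eval a

/-- The Laguerre polynomial of degree `m` with positive parameter `a`,
`(a)_m / m! * ₁F₁(-m; a; y)`, associated with the Gamma density `y ^ (a - 1) * exp (-y) / Γ(a)`. -/
def laguerre (a : ℝ) (m : ℕ) : ℝ[X] :=
  C (rising a m / m.factorial) *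
    ∑ k ∈ Finset.range (m + 1), C (rising (-(m : ℝ)) k / (rising a k * k.factorial)) * X ^ k

/-- The Jacobi polynomial on `[-1, 1]` with weight `(1 - x) ^ a * (1 + x) ^ b`,
`(a + 1)_n / n! * ₂F₁(-n, n + a + b + 1; a + 1; (1 - x) / 2)`. -/
def jacobi (a b : ℝ) (n : ℕ) : ℝ[X] :=
  C (rising (a + 1) n / n.factorial) *
    ∑ k ∈ Finset.range (n + 1),
      C (rising (-(n : ℝ)) k * rising (n + a + b + 1) k / (rising (a + 1) k * k.factorial)) *
        (C (1 / 2) * (1 - X)) ^ k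

/-- The shifted Jacobi polynomial `R_n^{α,β}` on `[0, 1]`, associated with the Beta`(α, β)`
distribution and standardized to take the value `1` at `1`. -/
def shiftedJacobi (α β : ℝ) (n : ℕ) : ℝ[X] :=
  C ((jacobi (β - 1) (α - 1) n).eval 1)⁻¹ * (jacobi (β - 1) (α - 1) n).comp (2 * X - 1)

/-! ### Polynomials on sequences

Coordinates of sequences are numbered from `0`; multi-indices `n ∈ ℕ^∞` with `|n| < ∞` are finitely
supported functions `ℕ →₀ ℕ`, and `|n|` is `Finsupp.degree n`. -/

/-- `N_j = ∑_{i > j} n_i`. -/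
def tailDegree (n : ℕ →₀ ℕ) (j : ℕ) : ℕ := ∑ i ∈ n.support with j < i, n i

/-- The polynomials `R_n` for the GEM`(θ)` distribution,
`∏_j R_{n_j}^{(1, θ + 2 N_j)} (x_j / (1 - s_{j-1})) * (1 - s_{j-1}) ^ n_j` with
`s_{j-1} = ∑_{i < j} x_i`. The factors with `n_j = 0` are equal to `1`, so the product runs over the
support of `n`. -/
def gemPoly (θ : ℝ) (n : ℕ →₀ ℕ) (x : ℕ → ℝ) : ℝ :=
  ∏ j ∈ n.support,
    (shiftedJacobi 1 (θ + 2 * tailDegree n j) (n j)).eval (x j / (1 - ∑ i ∈ Finset.range j, x i)) *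
      (1 - ∑ i ∈ Finset.range j, x i) ^ n j

/-- The infinite-dimensional multiple Laguerre polynomials
`L_m^{θ + 2|n|}(|y|) * |y| ^ |n| * R_n(y / |y|)`, where `|y| = ∑ y_i`. -/
def multipleLaguerre (θ : ℝ) (m : ℕ) (n : ℕ →₀ ℕ) (y : ℕ → ℝ) : ℝ :=
  (laguerre (θ + 2 * n.degree) m).eval (∑' i, y i) * (∑' i, y i) ^ n.degree *
    gemPoly θ n (fun j => y j / ∑' i, y i)

/-- `f` is, on the summable sequences with positive terms, a polynomial of total degree `d` in
`|y| = ∑ y_i` (the variable `none`) and finitely many of the coordinates `y_j` (the variables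
`some j`). -/
def IsPolynomialOfDegree (f : (ℕ → ℝ) → ℝ) (d : ℕ) : Prop :=
  ∃ p : MvPolynomial (Option ℕ) ℝ, p.totalDegree = d ∧
    ∀ y : ℕ → ℝ, (∀ i, 0 < y i) → Summable y →
      f y = MvPolynomial.eval (fun o : Option ℕ => o.elim (∑' i, y i) y) p

/-- An orthogonal system of nonzero functions in `L²(μ)`. -/
structure IsOrthogonalSystem {ι E : Type*} [MeasurableSpace E] (μ : Measure E) (f : ι → E → ℝ) :
    Prop where
  memLp : ∀ i, MemLp (f i) 2 μ
  orthogonal : ∀ i j, i ≠ j → ∫ y, f i y * f j y ∂μ = 0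
  norm_pos : ∀ i, 0 < ∫ y, f i y ^ 2 ∂μ

/-! ### The Gamma point process and its size-biased rearrangement -/

/-- The intensity measure `θ * y⁻¹ * exp (-y) dy` on `(0, ∞)`. -/
def gammaIntensity (θ : ℝ) : Measure ℝ :=
  (volume.restrict (Set.Ioi 0)).withDensity
    fun y => ENNReal.ofReal (θ * y⁻¹ * Real.exp (-y))

/-- The number of points of the sequence `y` in the set `A`. -/
def count (y : ℕ → ℝ) (A : Set ℝ) : ℝ≥0∞ := (Measure.sum fun i => Measure.dirac (y i)) A

/-- `Y 0, Y 1, …` is an enumeration (in an arbitrary, possibly random, order) of the points of a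
Poisson process with `σ`-finite intensity measure `Λ` of infinite total mass: the numbers of points
in pairwise disjoint sets are independent, and the number of points in a set `A` of finite intensity
has the Poisson distribution with mean `Λ A`. -/
structure IsPoissonProcess {Ω : Type*} [MeasurableSpace Ω] (P : Measure Ω) (Λ : Measure ℝ)
    (Y : ℕ → Ω → ℝ) : Prop where
  measurable : ∀ i, Measurable (Y i)
  count_law : ∀ A : Set ℝ, MeasurableSet A → Λ A ≠ ∞ →
    HasLaw (fun ω => count (fun i => Y i ω) A)
      ((poissonMeasure (Λ A).toNNReal).map (fun k : ℕ => (k : ℝ≥0∞))) P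
  count_indep : ∀ (r : ℕ) (A : Fin r → Set ℝ), (∀ i, MeasurableSet (A i)) →
    Pairwise (fun i j => Disjoint (A i) (A j)) →
    iIndepFun (fun i ω => count (fun l => Y l ω) (A i)) P

/-- The random indices `π 0, π 1, …` arrange the positive terms of the random sequence `Y` in
size-biased random order: given `Y`, they are drawn successively without replacement, and each time
an index `i` not yet drawn is chosen with probability `Y i` divided by the sum of the terms not yet
drawn. Thus, given `Y`, distinct `i 0, …, i (k - 1)` are the first `k` indices drawn with
probability `∏_j Y_{i_j} / (|Y| - ∑_{l < j} Y_{i_l})`. -/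
structure IsSizeBiasedOrder {Ω : Type*} [MeasurableSpace Ω] (P : Measure Ω)
    (Y : ℕ → Ω → ℝ) (π : ℕ → Ω → ℕ) : Prop where
  measurable : ∀ k, Measurable (π k)
  condProb : ∀ (k : ℕ) (i : Fin k → ℕ), Function.Injective i →
    P⟦{ω | ∀ j : Fin k, π j ω = i j} |
        MeasurableSpace.comap (fun ω l => Y l ω) MeasurableSpace.pi⟧ =ᵐ[P]
      fun ω => ∏ j : Fin k,
        Y (i j) ω / (∑' l, Y l ω - ∑ l ∈ Finset.univ.filter (· < j), Y (i l) ω)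

end

end GammaLaguerre

open Filter Topology

namespace GammaLaguerre

noncomputable section

/-!
The Laplace functional of a Poisson process determines, by differentiation, the multivariate Mecke
formula. The difference quotients of `t ↦ 1 - exp (-t * b)` at `0` increase along the steps
`2 ^ (-m)`, so monotone convergence justifies the differentiation. For the intensity
`θ * y⁻¹ * exp (-y)`, Mecke's formula and the beta-gamma algebra show that the total mass `|y|` is
Gamma`(θ)` distributed and that, independently of it, the sticks
`v_j = y_j / (|y| - ∑_{i < j} y_i)` of the size-biased rearrangement are i.i.d. Beta`(1, θ)`.

Since `1 - ∑_{i < j} y_i / |y| = ∏_{i < j} (1 - v_i)`, the multiple Laguerre polynomials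
factorize as
`L_m^{θ + 2|n|}(|y|) * |y| ^ |n| * ∏_j R_{n_j}^{(1, θ + 2 N_j)}(v_j) * (1 - v_j) ^ N_j`.
If `n ≠ n'`, let `j` be the largest index with `n_j ≠ n'_j`. Then `N_j = N'_j`, the weight
`(1 - v_j) ^ (2 N_j)` turns Beta`(1, θ)` into Beta`(1, θ + 2 N_j)`, and the integral over `v_j`
vanishes. If `n = n'`, the weight `|y| ^ (2|n|)` turns Gamma`(θ)` into Gamma`(θ + 2|n|)`, and the
integral over `|y|` vanishes.
-/

/-! ### The exponential `exp (-x)` on `[0, ∞]` -/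

/-- `exp (-x)` for `x ∈ [0, ∞]`, with `exp (-∞) = 0`; Laplace functionals of point processes are
expectations of this function at a possibly infinite sum. -/
def negExp (x : ℝ≥0∞) : ℝ≥0∞ := EReal.exp (-(x : EReal))

lemma negExp_ofReal {x : ℝ} (hx : 0 ≤ x) :
    negExp (ENNReal.ofReal x) = ENNReal.ofReal (Real.exp (-x)) := by
  rw [negExp, EReal.coe_ennreal_ofReal, max_eq_left hx, ← EReal.coe_neg, EReal.exp_coe]

lemma negExp_coe (x : ℝ≥0) : negExp x = ENNReal.ofReal (Real.exp (-x)) := by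
  rw [← negExp_ofReal x.coe_nonneg, ENNReal.ofReal_coe_nnreal]

@[simp] lemma negExp_zero : negExp 0 = 1 := by simp [negExp]

@[simp] lemma negExp_top : negExp ∞ = 0 := by simp [negExp]

lemma negExp_add (x y : ℝ≥0∞) : negExp (x + y) = negExp x * negExp y := by
  rw [negExp, negExp, negExp, ← EReal.exp_add, EReal.coe_ennreal_add,
    EReal.neg_add (by simp) (by simp), sub_eq_add_neg]

lemma negExp_sum {ι : Type*} (s : Finset ι) (x : ι → ℝ≥0∞) :
    negExp (∑ i ∈ s, x i) = ∏ i ∈ s, negExp (x i) := by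
  classical
  induction s using Finset.induction_on with
  | empty => simp
  | insert a s ha ih => rw [Finset.sum_insert ha, Finset.prod_insert ha, negExp_add, ih]

lemma negExp_nsmul (n : ℕ) (x : ℝ≥0∞) : negExp (n * x) = negExp x ^ n := by
  simpa using negExp_sum (Finset.range n) fun _ => x

lemma negExp_strictAnti : StrictAnti negExp := fun x y h => by
  simpa [negExp] using h

lemma negExp_le_one (x : ℝ≥0∞) : negExp x ≤ 1 := by
  simpa using negExp_strictAnti.antitone (zero_le (a := x))

lemma negExp_ne_top (x : ℝ≥0∞) : negExp x ≠ ∞ :=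
  ne_top_of_le_ne_top ENNReal.one_ne_top (negExp_le_one x)

lemma negExp_ne_zero {x : ℝ≥0∞} (hx : x ≠ ∞) : negExp x ≠ 0 := by
  simpa using (negExp_strictAnti hx.lt_top).ne'

lemma continuous_negExp : Continuous negExp :=
  ENNReal.continuous_exp.comp (continuous_neg.comp continuous_coe_ennreal_ereal)

@[fun_prop]
lemma measurable_negExp : Measurable negExp := continuous_negExp.measurable

/-- The difference quotient `2 ^ m * (1 - exp (-b / 2 ^ m))` of `t ↦ 1 - exp (-t * b)` at `0`.
Along the steps `2 ^ (-m)` it increases to `b`, so that differentiation under the integral sign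
reduces to monotone convergence. -/
def expQuotient (m : ℕ) (b : ℝ≥0∞) : ℝ≥0∞ := 2 ^ m * (1 - negExp (b / 2 ^ m))

@[fun_prop]
lemma measurable_expQuotient (m : ℕ) : Measurable (expQuotient m) := by
  unfold expQuotient
  fun_prop

lemma expQuotient_add_two_pow_mul_negExp (m : ℕ) (b : ℝ≥0∞) :
    expQuotient m b + 2 ^ m * negExp (b / 2 ^ m) = 2 ^ m := by
  rw [expQuotient, ← mul_add, tsub_add_cancel_of_le (negExp_le_one _), mul_one]

lemma one_sub_negExp_add_div (m : ℕ) (x b : ℝ≥0∞) :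
    1 - negExp (x + b / 2 ^ m) = (1 - negExp x) + negExp x * expQuotient m b / 2 ^ m := by
  rw [expQuotient, div_eq_mul_inv (_ * _), mul_assoc, mul_comm (2 ^ m), mul_assoc,
    ENNReal.mul_inv_cancel (by simp) (by simp), mul_one, negExp_add,
    ENNReal.mul_sub fun _ _ => negExp_ne_top _, mul_one,
    tsub_add_tsub_cancel (negExp_le_one _) (mul_le_of_le_one_right' (negExp_le_one _))]

lemma expQuotient_mono_right (m : ℕ) : Monotone (expQuotient m) := fun x y h => by
  unfold expQuotient
  gcongr
  exact negExp_strictAnti.antitone (by gcongr)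

lemma expQuotient_mono_left (b : ℝ≥0∞) : Monotone fun m => expQuotient m b := by
  refine monotone_nat_of_le_succ fun m => ?_
  have hb : b / 2 ^ m = b / 2 ^ (m + 1) + b / 2 ^ (m + 1) := by
    rw [← ENNReal.add_halves (b / 2 ^ m)]
    simp [div_eq_mul_inv, pow_succ, ENNReal.mul_inv, mul_assoc]
  obtain ⟨x, hx⟩ : ∃ x : ℝ≥0, (x : ℝ≥0∞) = negExp (b / 2 ^ (m + 1)) :=
    ⟨_, ENNReal.coe_toNNReal (negExp_ne_top _)⟩
  have hx1 : x ≤ 1 := by exact_mod_cast hx.symm ▸ negExp_le_one _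
  rw [expQuotient, expQuotient, hb, negExp_add, ← hx, pow_succ, mul_assoc]
  gcongr
  norm_cast
  rw [← NNReal.coe_le_coe, NNReal.coe_mul, NNReal.coe_sub (mul_le_one' hx1 hx1),
    NNReal.coe_sub hx1]
  push_cast
  nlinarith [sq_nonneg ((x : ℝ) - 1)]

lemma expQuotient_coe (m : ℕ) (b : ℝ≥0) :
    expQuotient m b = ENNReal.ofReal (2 ^ m * (1 - Real.exp (-(b / 2 ^ m)))) := by
  have hb : (b : ℝ≥0∞) / 2 ^ m = ENNReal.ofReal (b / 2 ^ m) := by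
    simp [ENNReal.ofReal_div_of_pos]
  rw [expQuotient, hb, negExp_ofReal (by positivity), ENNReal.ofReal_mul (by positivity),
    ENNReal.ofReal_sub _ (Real.exp_nonneg _)]
  simp

lemma tendsto_expQuotient (b : ℝ≥0∞) : Tendsto (fun m => expQuotient m b) atTop (𝓝 b) := by
  induction b with
  | top =>
    have h2 : Tendsto (fun m : ℕ => (2 : ℝ≥0∞) ^ m) atTop (𝓝 ∞) :=
      ENNReal.tendsto_pow_atTop_nhds_top_iff.2 (by norm_num)
    simp [expQuotient, ENNReal.top_div, h2]
  | coe b =>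
    simp_rw [expQuotient_coe, ← ENNReal.ofReal_coe_nnreal (p := b)]
    refine (ENNReal.continuous_ofReal.tendsto _).comp ?_
    have hd : HasDerivAt (fun t : ℝ => 1 - Real.exp (-(t * b))) b 0 := by
      simpa using (((hasDerivAt_id (0 : ℝ)).mul_const (b : ℝ)).neg.exp).const_sub 1
    have ht : Tendsto (fun m : ℕ => ((2 : ℝ) ^ m)⁻¹) atTop (𝓝[≠] 0) :=
      tendsto_nhdsWithin_iff.2
        ⟨tendsto_inv_atTop_zero.comp (tendsto_pow_atTop_atTop_of_one_lt (by norm_num)),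
          Eventually.of_forall fun m => by simp⟩
    refine (hd.tendsto_slope_zero.comp ht).congr fun m => ?_
    simp [div_eq_inv_mul]

lemma expQuotient_le (m : ℕ) (b : ℝ≥0∞) : expQuotient m b ≤ b :=
  (expQuotient_mono_left b).ge_of_tendsto (tendsto_expQuotient b) m

lemma tendsto_expQuotient_of_monotone {x : ℕ → ℝ≥0∞} {b : ℝ≥0∞} (hx : Monotone x)
    (h : Tendsto x atTop (𝓝 b)) : Tendsto (fun m => expQuotient m (x m)) atTop (𝓝 b) := by
  refine tendsto_order.2 ⟨fun a ha => ?_, fun a ha => Eventually.of_forall fun m =>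
    ((expQuotient_le m _).trans (hx.ge_of_tendsto h m)).trans_lt ha⟩
  obtain ⟨M, hM⟩ := ((tendsto_order.1 h).1 a ha).exists
  filter_upwards [(tendsto_order.1 (tendsto_expQuotient (x M))).1 a hM, eventually_ge_atTop M]
    with m hm hmM
  exact hm.trans_le (expQuotient_mono_right m (hx hmM))

section DifferenceQuotient

variable {α : Type*} [MeasurableSpace α] {μ : Measure α} {g u : α → ℝ≥0∞}

lemma monotone_lintegral_mul_expQuotient :
    Monotone fun m => ∫⁻ x, g x * expQuotient m (u x) ∂μ := fun _ _ hmn =>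
  lintegral_mono fun x => mul_le_mul_right (expQuotient_mono_left (u x) hmn) _

lemma tendsto_lintegral_mul_expQuotient (hg : Measurable g) (hu : Measurable u)
    (hg_top : ∀ x, g x ≠ ∞) :
    Tendsto (fun m => ∫⁻ x, g x * expQuotient m (u x) ∂μ) atTop (𝓝 (∫⁻ x, g x * u x ∂μ)) :=
  lintegral_tendsto_of_tendsto_of_monotone (fun m => by fun_prop)
    (Eventually.of_forall fun x _ _ hmn => mul_le_mul_right (expQuotient_mono_left (u x) hmn) _)
    (Eventually.of_forall fun x =>
      ENNReal.Tendsto.const_mul (tendsto_expQuotient (u x)) (Or.inr (hg_top x)))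

lemma lintegral_mul_expQuotient_add (hg : Measurable g) (hu : Measurable u) (m : ℕ) :
    ∫⁻ x, g x * expQuotient m (u x) ∂μ + 2 ^ m * ∫⁻ x, g x * negExp (u x / 2 ^ m) ∂μ =
      2 ^ m * ∫⁻ x, g x ∂μ := by
  rw [← lintegral_const_mul _ (by fun_prop), ← lintegral_add_left (by fun_prop),
    ← lintegral_const_mul _ hg]
  refine lintegral_congr fun x => ?_
  rw [mul_left_comm, ← mul_add, expQuotient_add_two_pow_mul_negExp, mul_comm]

end DifferenceQuotient

/-! ### The Laplace functional of a Poisson process -/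

lemma lintegral_negExp_poissonMeasure (r c : ℝ≥0) :
    ∫⁻ k, negExp (c * (k : ℝ≥0∞)) ∂(poissonMeasure r) = negExp (r * (1 - negExp c)) := by
  have hexp : (r : ℝ≥0∞) * (1 - negExp c) = ENNReal.ofReal (r * (1 - Real.exp (-c))) := by
    rw [negExp_coe, ENNReal.ofReal_mul r.coe_nonneg, ENNReal.ofReal_sub _ (Real.exp_nonneg _)]
    simp
  have hterm (k : ℕ) : negExp (c * (k : ℝ≥0∞)) * poissonMeasure r {k}
      = ENNReal.ofReal (Real.exp (-r) * ((r * Real.exp (-c)) ^ k / k.factorial)) := by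
    rw [mul_comm (c : ℝ≥0∞), negExp_nsmul, negExp_coe, poissonMeasure_singleton,
      ← ENNReal.ofReal_pow (Real.exp_nonneg _), ← ENNReal.ofReal_mul (by positivity)]
    congr 1
    ring
  have hsum := (NormedSpace.expSeries_div_hasSum_exp ((r : ℝ) * Real.exp (-c))).mul_left
    (Real.exp (-r))
  rw [hexp, negExp_ofReal (mul_nonneg r.coe_nonneg (by simp)), lintegral_countable']
  simp_rw [hterm]
  rw [← ENNReal.ofReal_tsum_of_nonneg (fun k => by positivity) hsum.summable, hsum.tsum_eq,
    ← Real.exp_eq_exp_ℝ, ← Real.exp_add]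
  ring_nf

lemma lintegral_sum_dirac {ι E : Type*} [MeasurableSpace E] {y : ι → E} {f : E → ℝ≥0∞}
    (hf : Measurable f) :
    ∫⁻ x, f x ∂(Measure.sum fun i => Measure.dirac (y i)) = ∑' i, f (y i) := by
  rw [lintegral_sum_measure]
  simp_rw [lintegral_dirac' _ hf]

lemma exists_simpleFunc_monotone_tendsto {E : Type*} [MeasurableSpace E] (Λ : Measure E)
    [SigmaFinite Λ] {f : E → ℝ≥0∞} (hf : Measurable f) :
    ∃ g : ℕ → SimpleFunc E ℝ≥0∞, (∀ n x, g n x ≠ ∞) ∧ (∀ n, (g n).FinMeasSupp Λ) ∧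
      (∀ x, Monotone fun n => g n x) ∧ ∀ x, Tendsto (fun n => g n x) atTop (𝓝 (f x)) := by
  have hg (n x) : (SimpleFunc.eapprox f n).restrict (spanningSets Λ n) x =
      (spanningSets Λ n).indicator (SimpleFunc.eapprox f n) x := by
    rw [SimpleFunc.restrict_apply _ (measurableSet_spanningSets Λ n)]
  refine ⟨fun n => (SimpleFunc.eapprox f n).restrict (spanningSets Λ n), fun n x => ?_,
    fun n => ?_, fun x m n hmn => ?_, fun x => ?_⟩
  · rw [hg]
    exact ((Set.indicator_le_self _ _ x).trans_lt (SimpleFunc.eapprox_lt_top f n x)).ne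
  · refine SimpleFunc.finMeasSupp_iff_support.2
      ((measure_mono fun x hx => ?_).trans_lt (measure_spanningSets_lt_top Λ n))
    rw [Function.mem_support, hg] at hx
    exact Set.mem_of_indicator_ne_zero hx
  · simp only [hg]
    exact (Set.indicator_le_indicator_of_subset (monotone_spanningSets Λ hmn) (fun _ => zero_le)
      x).trans (Set.indicator_le_indicator (SimpleFunc.monotone_eapprox f hmn x))
  · have htends : Tendsto (fun n => SimpleFunc.eapprox f n x) atTop (𝓝 (f x)) := by
      rw [← SimpleFunc.iSup_eapprox_apply hf x]
      exact tendsto_atTop_iSup fun m n h => SimpleFunc.monotone_eapprox f h x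
    refine htends.congr' ?_
    filter_upwards [eventually_ge_atTop (spanningSetsIndex Λ x)] with n hn
    rw [hg, Set.indicator_of_mem]
    exact monotone_spanningSets Λ hn (mem_spanningSetsIndex Λ x)

namespace IsPoissonProcess

variable {Ω : Type*} [MeasurableSpace Ω] {P : Measure Ω} {Λ : Measure ℝ} {Y : ℕ → Ω → ℝ}

lemma measurable_count (hY : IsPoissonProcess P Λ Y) {A : Set ℝ} (hA : MeasurableSet A) :
    Measurable fun ω => count (fun i => Y i ω) A := by
  unfold count
  simp_rw [Measure.sum_apply _ hA, Measure.dirac_apply' _ hA]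
  exact Measurable.tsum fun i => (measurable_const.indicator hA).comp (hY.measurable i)

lemma iIndepFun_count (hY : IsPoissonProcess P Λ Y) {ι : Type*} [Finite ι] {A : ι → Set ℝ}
    (hA : ∀ i, MeasurableSet (A i)) (hd : Pairwise fun i j => Disjoint (A i) (A j)) :
    iIndepFun (fun i ω => count (fun l => Y l ω) (A i)) P := by
  obtain ⟨n, ⟨e⟩⟩ := Finite.exists_equiv_fin ι
  have hind := hY.count_indep n (A ∘ e.symm) (fun i => hA _)
    fun i j hij => hd (e.symm.injective.ne hij)
  simpa using hind.precomp e.injective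

lemma lintegral_negExp_count (hY : IsPoissonProcess P Λ Y) {A : Set ℝ} (hA : MeasurableSet A)
    (hΛ : Λ A ≠ ∞) {c : ℝ≥0∞} (hc : c ≠ ∞) :
    ∫⁻ ω, negExp (c * count (fun i => Y i ω) A) ∂P = negExp ((1 - negExp c) * Λ A) := by
  lift c to ℝ≥0 using hc
  rw [← lintegral_map (f := fun x => negExp (c * x)) (by fun_prop) (hY.measurable_count hA),
    (hY.count_law A hA hΛ).map_eq, lintegral_map (by fun_prop) (by fun_prop),
    lintegral_negExp_poissonMeasure, ENNReal.coe_toNNReal hΛ, mul_comm]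

lemma lintegral_negExp_simpleFunc [IsProbabilityMeasure P] (hY : IsPoissonProcess P Λ Y)
    (f : SimpleFunc ℝ ℝ≥0∞) (hf : ∀ x, f x ≠ ∞) (hΛ : f.FinMeasSupp Λ) :
    ∫⁻ ω, negExp (∑' i, f (Y i ω)) ∂P = negExp (∫⁻ y, 1 - negExp (f y) ∂Λ) := by
  have hlevel (c : f.range) : ∫⁻ ω, negExp (c * count (fun i => Y i ω) (f ⁻¹' {(c : ℝ≥0∞)})) ∂P =
      negExp ((1 - negExp c) * Λ (f ⁻¹' {(c : ℝ≥0∞)})) := by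
    obtain ⟨x, hx⟩ := SimpleFunc.mem_range.1 c.2
    rcases eq_or_ne (c : ℝ≥0∞) 0 with hc | hc
    · simp [hc]
    · exact hY.lintegral_negExp_count (f.measurableSet_preimage _)
        (hΛ.meas_preimage_singleton_ne_zero hc).ne (hx ▸ hf x)
  have hpoint (ω) : negExp (∑' i, f (Y i ω)) =
      ∏ c : f.range, negExp (c * count (fun i => Y i ω) (f ⁻¹' {(c : ℝ≥0∞)})) := by
    rw [← lintegral_sum_dirac f.measurable, SimpleFunc.lintegral_eq_lintegral,
      SimpleFunc.lintegral, ← Finset.sum_coe_sort, negExp_sum]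
    rfl
  have hintensity : ∫⁻ y, 1 - negExp (f y) ∂Λ =
      ∑ c : f.range, (1 - negExp c) * Λ (f ⁻¹' {(c : ℝ≥0∞)}) := by
    rw [Finset.sum_coe_sort f.range fun c => (1 - negExp c) * Λ (f ⁻¹' {c}),
      ← SimpleFunc.map_lintegral (fun c => 1 - negExp c), ← SimpleFunc.lintegral_eq_lintegral]
    rfl
  have hind := (hY.iIndepFun_count (fun c : f.range => f.measurableSet_preimage {(c : ℝ≥0∞)})
    fun c d hcd => Disjoint.preimage f
      (Set.disjoint_singleton.2 fun h => hcd (Subtype.ext h))).comp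
    (fun c x => negExp (c * x)) fun c => by fun_prop
  simp_rw [hpoint]
  rw [hintensity, negExp_sum]
  refine (lintegral_prod_eq_prod_lintegral_of_indepFun _ _ hind fun c => ?_).trans
    (Finset.prod_congr rfl fun c _ => hlevel c)
  exact measurable_negExp.comp ((hY.measurable_count (f.measurableSet_preimage _)).const_mul _)

lemma lintegral_negExp [IsProbabilityMeasure P] [SigmaFinite Λ] (hY : IsPoissonProcess P Λ Y)
    {f : ℝ → ℝ≥0∞} (hf : Measurable f) :
    ∫⁻ ω, negExp (∑' i, f (Y i ω)) ∂P = negExp (∫⁻ y, 1 - negExp (f y) ∂Λ) := by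
  obtain ⟨g, hg_top, hg_supp, hg_mono, hg_tendsto⟩ := exists_simpleFunc_monotone_tendsto Λ hf
  have hlim (μ : Measure ℝ) {φ : ℝ≥0∞ → ℝ≥0∞} (hφ : Monotone φ) (hφc : Continuous φ) :
      Tendsto (fun n => ∫⁻ y, φ (g n y) ∂μ) atTop (𝓝 (∫⁻ y, φ (f y) ∂μ)) :=
    lintegral_tendsto_of_tendsto_of_monotone
      (fun n => (hφc.measurable.comp (g n).measurable).aemeasurable)
      (Eventually.of_forall fun y _ _ h => hφ (hg_mono y h))
      (Eventually.of_forall fun y => (hφc.tendsto _).comp (hg_tendsto y))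
  have hP : Tendsto (fun n => ∫⁻ ω, negExp (∑' i, g n (Y i ω)) ∂P) atTop
      (𝓝 (∫⁻ ω, negExp (∑' i, f (Y i ω)) ∂P)) := by
    refine tendsto_lintegral_of_dominated_convergence (fun _ => 1)
      (fun n => measurable_negExp.comp
        (Measurable.tsum fun i => (g n).measurable.comp (hY.measurable i)))
      (fun n => Eventually.of_forall fun ω => negExp_le_one _) (by simp)
      (Eventually.of_forall fun ω => (continuous_negExp.tendsto _).comp ?_)
    simpa only [id, lintegral_sum_dirac (g _).measurable, lintegral_sum_dirac hf]
      using hlim (Measure.sum fun i => Measure.dirac (Y i ω)) monotone_id continuous_id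
  have hΛ : Tendsto (fun n => negExp (∫⁻ y, 1 - negExp (g n y) ∂Λ)) atTop
      (𝓝 (negExp (∫⁻ y, 1 - negExp (f y) ∂Λ))) :=
    (continuous_negExp.tendsto _).comp <| hlim Λ (φ := fun x => 1 - negExp x)
      (fun x y h => tsub_le_tsub_left (negExp_strictAnti.antitone h) _)
      ((ENNReal.continuous_sub_left ENNReal.one_ne_top).comp continuous_negExp)
  exact tendsto_nhds_unique hP
    (hΛ.congr fun n => (hY.lintegral_negExp_simpleFunc (g n) (hg_top n) (hg_supp n)).symm)

end IsPoissonProcess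

/-! ### The multivariate Mecke formula -/

lemma lintegral_mul_negExp_of_laplaceFunctional {X E : Type*} [MeasurableSpace X]
    [MeasurableSpace E] {μ : Measure X} {Λ : Measure E} {ξ : X → Measure E} (hξ : Measurable ξ)
    {w : X → ℝ≥0∞} (hw : Measurable w) (hw_top : ∀ x, w x ≠ ∞) {p : ℝ≥0∞} (hp : p ≠ ∞)
    (hL : ∀ f : E → ℝ≥0∞, Measurable f → (∀ y, f y ≠ ∞) →
      ∫⁻ x, w x * negExp (∫⁻ y, f y ∂ξ x) ∂μ = p * negExp (∫⁻ y, 1 - negExp (f y) ∂Λ))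
    {u f : E → ℝ≥0∞} (hu : Measurable u) (hu_top : ∀ y, u y ≠ ∞) (hf : Measurable f)
    (hf_top : ∀ y, f y ≠ ∞) :
    ∫⁻ x, w x * negExp (∫⁻ y, f y ∂ξ x) * ∫⁻ y, u y ∂ξ x ∂μ =
      p * negExp (∫⁻ y, 1 - negExp (f y) ∂Λ) * ∫⁻ y, negExp (f y) * u y ∂Λ := by
  have hint {v : E → ℝ≥0∞} (hv : Measurable v) : Measurable fun x => ∫⁻ y, v y ∂ξ x :=
    (Measure.measurable_lintegral hv).comp hξ
  have hG : Measurable fun x => w x * negExp (∫⁻ y, f y ∂ξ x) :=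
    hw.mul (measurable_negExp.comp (hint hf))
  set G := fun x => w x * negExp (∫⁻ y, f y ∂ξ x)
  set a := p * negExp (∫⁻ y, 1 - negExp (f y) ∂Λ)
  have ha_top : a ≠ ∞ := ENNReal.mul_ne_top hp (negExp_ne_top _)
  set B := fun m : ℕ => ∫⁻ y, negExp (f y) * expQuotient m (u y) ∂Λ
  -- Differentiate the Laplace functional at `f` in the direction `u`.
  have hperturb (m : ℕ) : ∫⁻ x, G x * negExp ((∫⁻ y, u y ∂ξ x) / 2 ^ m) ∂μ =
      a * negExp (B m / 2 ^ m) := by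
    have hleft (x) : G x * negExp ((∫⁻ y, u y ∂ξ x) / 2 ^ m) =
        w x * negExp (∫⁻ y, f y + u y / 2 ^ m ∂ξ x) := by
      simp only [G, div_eq_mul_inv]
      rw [lintegral_add_left hf, lintegral_mul_const _ hu, negExp_add, mul_assoc]
    simp_rw [hleft]
    rw [hL _ (by fun_prop) fun y => by
      simp [hf_top y, ENNReal.div_eq_top, hu_top y]]
    simp_rw [one_sub_negExp_add_div, div_eq_mul_inv]
    rw [lintegral_add_left (by fun_prop), lintegral_mul_const _ (by fun_prop), negExp_add,
      ← mul_assoc]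
  have hquot (m : ℕ) : ∫⁻ x, G x * expQuotient m (∫⁻ y, u y ∂ξ x) ∂μ = a * expQuotient m (B m) := by
    have hfin : 2 ^ m * (a * negExp (B m / 2 ^ m)) ≠ ∞ := by
      finiteness [negExp_ne_top (B m / 2 ^ m)]
    rw [← ENNReal.add_left_inj hfin, ← hperturb, lintegral_mul_expQuotient_add hG (hint hu),
      hperturb, hL f hf hf_top, mul_left_comm _ a, ← mul_add, expQuotient_add_two_pow_mul_negExp,
      mul_comm]
  refine tendsto_nhds_unique (tendsto_lintegral_mul_expQuotient hG (hint hu)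
    fun x => ENNReal.mul_ne_top (hw_top x) (negExp_ne_top _)) ?_
  refine Tendsto.congr (fun m => (hquot m).symm) ?_
  exact ENNReal.Tendsto.const_mul (tendsto_expQuotient_of_monotone
    monotone_lintegral_mul_expQuotient
    (tendsto_lintegral_mul_expQuotient (by fun_prop) hu fun y => negExp_ne_top _)) (Or.inr ha_top)

lemma tsum_compl_eq_add_tsum_compl_insert {ι : Type*} {s : Set ι} {a : ι} (ha : a ∉ s)
    (f : ι → ℝ≥0∞) :
    ∑' l : ↥sᶜ, f l = f a + ∑' l : ↥(insert a s)ᶜ, f l := by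
  have hs : sᶜ = {a} ∪ (insert a s)ᶜ := by
    ext l
    by_cases h : l = a <;> simp [h, ha]
  rw [tsum_congr_set_coe f hs, ENNReal.summable.tsum_union_disjoint (by simp) ENNReal.summable,
    tsum_singleton a f]

lemma tsum_embedding_finSucc {ι : Type*} {k : ℕ} (F : (Fin (k + 1) → ι) → ℝ≥0∞) :
    ∑' i : Fin (k + 1) ↪ ι, F i =
      ∑' i : Fin k ↪ ι, ∑' l : ↥(Set.range i)ᶜ, F (Fin.cons (l : ι) i) := by
  rw [← (Equiv.embeddingFinSucc k ι).symm.tsum_eq]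
  simp_rw [Equiv.coe_embeddingFinSucc_symm]
  exact ENNReal.tsum_sigma' _

lemma measurable_sum_dirac {X ι E : Type*} [MeasurableSpace X] [MeasurableSpace E] [Countable ι]
    {y : ι → X → E} (hy : ∀ i, Measurable (y i)) :
    Measurable fun x => Measure.sum fun i => Measure.dirac (y i x) := by
  refine Measure.measurable_of_measurable_coe _ fun s hs => ?_
  simp_rw [Measure.sum_apply _ hs, Measure.dirac_apply' _ hs]
  exact Measurable.tsum fun i => (measurable_const.indicator hs).comp (hy i)

lemma lintegral_prod_count {X κ : Type*} [MeasurableSpace X] [MeasurableSpace κ] [Countable κ]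
    [MeasurableSingletonClass κ] {μ : Measure X} [SFinite μ] {F : κ → X → ℝ≥0∞}
    (hF : ∀ i, Measurable (F i)) :
    ∫⁻ z, F z.2 z.1 ∂μ.prod Measure.count = ∫⁻ x, ∑' i, F i x ∂μ := by
  have hF' : Measurable fun z : X × κ => F z.2 z.1 := measurable_from_prod_countable_left hF
  rw [lintegral_prod _ hF'.aemeasurable]
  simp_rw [lintegral_count]

lemma lintegral_tsum_mul_tsum_of_laplaceFunctional {Ω κ ι E : Type*} [MeasurableSpace Ω]
    [Countable κ] [Countable ι] [MeasurableSpace E] {P : Measure Ω} [SFinite P] {Λ : Measure E}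
    {Y : ι → Ω → E} (hY : ∀ l, Measurable (Y l)) (s : κ → Set ι) {w : κ → Ω → ℝ≥0∞}
    (hw : ∀ i, Measurable (w i)) (hw_top : ∀ i ω, w i ω ≠ ∞) {p : ℝ≥0∞} (hp : p ≠ ∞)
    (hL : ∀ f : E → ℝ≥0∞, Measurable f → (∀ y, f y ≠ ∞) →
      ∫⁻ ω, ∑' i, w i ω * negExp (∑' l : s i, f (Y l ω)) ∂P =
        p * negExp (∫⁻ y, 1 - negExp (f y) ∂Λ))
    {u f : E → ℝ≥0∞} (hu : Measurable u) (hu_top : ∀ y, u y ≠ ∞) (hf : Measurable f)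
    (hf_top : ∀ y, f y ≠ ∞) :
    ∫⁻ ω, ∑' i, w i ω * negExp (∑' l : s i, f (Y l ω)) * ∑' l : s i, u (Y l ω) ∂P =
      p * negExp (∫⁻ y, 1 - negExp (f y) ∂Λ) * ∫⁻ y, negExp (f y) * u y ∂Λ := by
  let _ : MeasurableSpace κ := ⊤
  have hsum (i) {v : E → ℝ≥0∞} (hv : Measurable v) : Measurable fun ω => ∑' l : s i, v (Y l ω) :=
    Measurable.tsum fun l => hv.comp (hY l)
  have hwf (i) {v : E → ℝ≥0∞} (hv : Measurable v) :
      Measurable fun ω => w i ω * negExp (∑' l : s i, v (Y l ω)) :=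
    (hw i).mul (measurable_negExp.comp (hsum i hv))
  have hwfu (i) : Measurable fun ω =>
      w i ω * negExp (∑' l : s i, f (Y l ω)) * ∑' l : s i, u (Y l ω) :=
    (hwf i hf).mul (hsum i hu)
  have hξ : Measurable fun z : Ω × κ => Measure.sum fun l : s z.2 => Measure.dirac (Y l z.1) :=
    measurable_from_prod_countable_left fun i =>
      measurable_sum_dirac (y := fun l : s i => Y l) fun l => hY l
  have hw' : Measurable fun z : Ω × κ => w z.2 z.1 := measurable_from_prod_countable_left hw
  have key := lintegral_mul_negExp_of_laplaceFunctional (μ := P.prod Measure.count) (Λ := Λ) hξ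
    hw' (fun z => hw_top _ _) hp (fun v hv hv_top => ?hL) hu hu_top hf hf_top
  case hL =>
    simp_rw [lintegral_sum_dirac hv]
    rw [lintegral_prod_count fun i => hwf i hv, hL v hv hv_top]
  rw [← key, ← lintegral_prod_count hwfu]
  simp_rw [lintegral_sum_dirac hf, lintegral_sum_dirac hu]

lemma tsum_embedding_finSucc_mul_negExp {ι : Type*} {k : ℕ} (b : Fin (k + 1) → ι → ℝ≥0∞)
    {a : ι → ℝ≥0∞} (ha : ∀ l, a l ≠ ∞) :
    ∑' i : Fin (k + 1) ↪ ι, (∏ j, b j (i j)) * negExp (∑' l : ↥(Set.range i)ᶜ, a l) =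
      ∑' i : Fin k ↪ ι, (∏ j : Fin k, b j.succ (i j)) * negExp (∑' l : ↥(Set.range i)ᶜ, a l) *
        ∑' l : ↥(Set.range i)ᶜ, b 0 l * (negExp (a l))⁻¹ := by
  rw [tsum_embedding_finSucc fun i =>
    (∏ j, b j (i j)) * negExp (∑' l : ↥(Set.range i)ᶜ, a l)]
  refine tsum_congr fun i => ?_
  rw [← ENNReal.tsum_mul_left]
  refine tsum_congr fun l => ?_
  have hcancel : negExp (a l) * (negExp (a l))⁻¹ = 1 :=
    ENNReal.mul_inv_cancel (negExp_ne_zero (ha _)) (negExp_ne_top _)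
  rw [Fin.range_cons, tsum_compl_eq_add_tsum_compl_insert l.2 a, negExp_add,
    Fin.prod_univ_succ, Fin.cons_zero]
  simp only [Fin.cons_succ]
  calc b 0 l * (∏ j : Fin k, b j.succ (i j)) * negExp (∑' m : ↥(insert (l : ι) (Set.range i))ᶜ, a m)
      = (∏ j : Fin k, b j.succ (i j)) * negExp (∑' m : ↥(insert (l : ι) (Set.range i))ᶜ, a m) *
          b 0 l * (negExp (a l) * (negExp (a l))⁻¹) := by rw [hcancel]; ring
    _ = _ := by ring

theorem lintegral_tsum_embedding_of_laplaceFunctional {Ω ι E : Type*} [MeasurableSpace Ω]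
    [Countable ι] [MeasurableSpace E] {P : Measure Ω} [SFinite P] {Λ : Measure E} {Y : ι → Ω → E}
    (hY : ∀ i, Measurable (Y i))
    (hL : ∀ f : E → ℝ≥0∞, Measurable f → (∀ y, f y ≠ ∞) →
      ∫⁻ ω, negExp (∑' i, f (Y i ω)) ∂P = negExp (∫⁻ y, 1 - negExp (f y) ∂Λ))
    {k : ℕ} {g : Fin k → E → ℝ≥0∞} (hg : ∀ j, Measurable (g j)) (hg_top : ∀ j y, g j y ≠ ∞)
    (hgΛ : ∀ j, ∫⁻ y, g j y ∂Λ ≠ ∞) {f : E → ℝ≥0∞} (hf : Measurable f) (hf_top : ∀ y, f y ≠ ∞) :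
    ∫⁻ ω, ∑' i : Fin k ↪ ι,
        (∏ j, g j (Y (i j) ω)) * negExp (∑' l : ↥(Set.range i)ᶜ, f (Y l ω)) ∂P =
      (∏ j, ∫⁻ y, g j y ∂Λ) * negExp (∫⁻ y, 1 - negExp (f y) ∂Λ) := by
  induction k generalizing f with
  | zero =>
    have hempty (i : Fin 0 ↪ ι) (ω) : ∑' l : ↥(Set.range i)ᶜ, f (Y l ω) = ∑' l, f (Y l ω) := by
      rw [Set.range_eq_empty, Set.compl_empty]
      exact tsum_univ fun l => f (Y l ω)
    simp_rw [hempty, tsum_fintype]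
    simp [hL f hf hf_top]
  | succ k ih =>
    have : Countable (Fin k ↪ ι) := DFunLike.coe_injective.countable
    simp_rw [fun ω => tsum_embedding_finSucc_mul_negExp (fun j l => g j (Y l ω))
      fun l => hf_top (Y l ω)]
    rw [lintegral_tsum_mul_tsum_of_laplaceFunctional hY (fun i : Fin k ↪ ι => (Set.range i)ᶜ)
      (w := fun i ω => ∏ j : Fin k, g j.succ (Y (i j) ω))
      (fun i => Finset.measurable_fun_prod _ fun j _ => (hg (Fin.succ j)).comp (hY (i j)))
      (fun i ω => ENNReal.prod_ne_top fun j _ => hg_top _ _)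
      (ENNReal.prod_ne_top fun j _ => hgΛ (Fin.succ j))
      (fun v hv hv_top => ih (fun j => hg _) (fun j => hg_top _) (fun j => hgΛ _) hv hv_top)
      (u := fun y => g 0 y * (negExp (f y))⁻¹) ((hg 0).mul (by fun_prop))
      (fun y => ENNReal.mul_ne_top (hg_top 0 y) (ENNReal.inv_ne_top.2 (negExp_ne_zero (hf_top y))))
      hf hf_top, Fin.prod_univ_succ, mul_right_comm, mul_comm (∏ j : Fin k, _)]
    congr! 4 with y
    rw [mul_left_comm, ENNReal.mul_inv_cancel (negExp_ne_zero (hf_top y)) (negExp_ne_top _),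
      mul_one]

theorem IsPoissonProcess.lintegral_tsum_embedding {Ω : Type*} [MeasurableSpace Ω] {P : Measure Ω}
    [IsProbabilityMeasure P] {Λ : Measure ℝ} [SigmaFinite Λ] {Y : ℕ → Ω → ℝ}
    (hY : IsPoissonProcess P Λ Y) {k : ℕ} {g : Fin k → ℝ → ℝ≥0∞} (hg : ∀ j, Measurable (g j))
    (hg_top : ∀ j y, g j y ≠ ∞) (hgΛ : ∀ j, ∫⁻ y, g j y ∂Λ ≠ ∞) {f : ℝ → ℝ≥0∞}
    (hf : Measurable f) (hf_top : ∀ y, f y ≠ ∞) :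
    ∫⁻ ω, ∑' i : Fin k ↪ ℕ,
        (∏ j, g j (Y (i j) ω)) * negExp (∑' l : ↥(Set.range i)ᶜ, f (Y l ω)) ∂P =
      (∏ j, ∫⁻ y, g j y ∂Λ) * negExp (∫⁻ y, 1 - negExp (f y) ∂Λ) :=
  lintegral_tsum_embedding_of_laplaceFunctional hY.measurable
    (fun _ hv _ => hY.lintegral_negExp hv) hg hg_top hgΛ hf hf_top

theorem ext_of_integral_pow {E : Type*} [TopologicalSpace E] [PolishSpace E] [MeasurableSpace E]
    [BorelSpace E] {μ ν : Measure E} [IsFiniteMeasure μ] [IsFiniteMeasure ν]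
    {f : BoundedContinuousFunction E ℝ} (hf : Function.Injective f)
    (h : ∀ n : ℕ, ∫ x, f x ^ n ∂μ = ∫ x, f x ^ n ∂ν) : μ = ν := by
  let A : StarSubalgebra ℝ (BoundedContinuousFunction E ℝ) :=
    { (aeval f : ℝ[X] →ₐ[ℝ] BoundedContinuousFunction E ℝ).range with
      star_mem' := fun {a} ha => by rwa [show star a = a by ext x; simp] }
  refine ext_of_forall_mem_subalgebra_integral_eq_of_polish (𝕜 := ℝ) (A := A) ?_ ?_
  · exact fun x y hxy =>
      ⟨f, ⟨f.toContinuousMap, ⟨f, ⟨X, by simp⟩, rfl⟩, rfl⟩, fun hfxy => hxy (hf hfxy)⟩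
  · rintro _ ⟨p, rfl⟩
    have hlin (ρ : Measure E) [IsFiniteMeasure ρ] :
        ∫ x, (aeval f p : BoundedContinuousFunction E ℝ) x ∂ρ =
          ∑ n ∈ p.support, p.coeff n * ∫ x, f x ^ n ∂ρ := by
      simp_rw [← integral_const_mul]
      rw [← integral_finsetSum _ fun n _ => by exact ((f ^ n).integrable ρ).const_mul _]
      refine integral_congr_ae (Eventually.of_forall fun x => ?_)
      simp [aeval_def, eval₂_eq_sum, Polynomial.sum, BoundedContinuousFunction.coe_sum]
    simp only [AlgHom.toRingHom_eq_coe, RingHom.coe_coe]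
    simp_rw [hlin, h]

theorem ext_of_lintegral_negExp {μ ν : Measure ℝ≥0∞} [IsFiniteMeasure μ] [IsFiniteMeasure ν]
    (h : ∀ n : ℕ, ∫⁻ x, negExp (n * x) ∂μ = ∫⁻ x, negExp (n * x) ∂ν) : μ = ν := by
  have hcont : Continuous fun x => (negExp x).toReal :=
    ENNReal.continuousOn_toReal.comp_continuous continuous_negExp negExp_ne_top
  let f : BoundedContinuousFunction ℝ≥0∞ ℝ :=
    BoundedContinuousFunction.ofNormedAddCommGroup _ hcont 1 fun x => by
      rw [Real.norm_of_nonneg ENNReal.toReal_nonneg]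
      exact ENNReal.toReal_le_of_le_ofReal zero_le_one (by simpa using negExp_le_one x)
  have hf : Function.Injective f := fun x y hxy => negExp_strictAnti.injective
    ((ENNReal.toReal_eq_toReal_iff' (negExp_ne_top x) (negExp_ne_top y)).1 hxy)
  have hpow (ρ : Measure ℝ≥0∞) (n : ℕ) :
      ∫ x, f x ^ n ∂ρ = (∫⁻ x, negExp (n * x) ∂ρ).toReal := by
    rw [← integral_toReal (by fun_prop) (Eventually.of_forall fun x => (negExp_ne_top _).lt_top)]
    simp only [negExp_nsmul, ENNReal.toReal_pow]
    rfl
  exact ext_of_integral_pow hf fun n => by rw [hpow, hpow, h]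

lemma generateFrom_measurableSet_measure_ne_top {E : Type*} [mE : MeasurableSpace E]
    (μ : Measure E) [SigmaFinite μ] :
    MeasurableSpace.generateFrom {s | MeasurableSet s ∧ μ s ≠ ∞} = mE := by
  refine le_antisymm (MeasurableSpace.generateFrom_le fun s hs => hs.1) fun s hs => ?_
  rw [← Set.inter_univ s, ← iUnion_spanningSets μ, Set.inter_iUnion]
  exact MeasurableSet.iUnion fun n => MeasurableSpace.measurableSet_generateFrom
    ⟨hs.inter (measurableSet_spanningSets _ n),
      measure_ne_top_of_subset Set.inter_subset_right (measure_spanningSets_lt_top _ n).ne⟩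

theorem pi_prod_eq_of_rectangles {ι E F : Type*} [Fintype ι] [MeasurableSpace E]
    [MeasurableSpace F] {Λ : Measure E} [SigmaFinite Λ] {ν : Measure F} [SigmaFinite ν]
    {M : Measure ((ι → E) × F)}
    (h : ∀ s : ι → Set E, (∀ j, MeasurableSet (s j)) → (∀ j, Λ (s j) ≠ ∞) →
      ∀ t, MeasurableSet t → M (Set.pi Set.univ s ×ˢ t) = (∏ j, Λ (s j)) * ν t) :
    (Measure.pi fun _ => Λ).prod ν = M := by
  have hpi : IsPiSystem {s | MeasurableSet s ∧ Λ s ≠ ∞} := fun s hs t ht _ =>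
    ⟨hs.1.inter ht.1, measure_ne_top_of_subset Set.inter_subset_left hs.2⟩
  let hspan : Λ.FiniteSpanningSetsIn {s | MeasurableSet s ∧ Λ s ≠ ∞} :=
    { set := spanningSets Λ
      set_mem := fun n => ⟨measurableSet_spanningSets _ n, (measure_spanningSets_lt_top _ n).ne⟩
      finite := measure_spanningSets_lt_top _
      spanning := iUnion_spanningSets _ }
  refine Measure.prod_eq_generateFrom
    (generateFrom_eq_pi (fun _ => generateFrom_measurableSet_measure_ne_top Λ)
      fun _ => hspan.isCountablySpanning)
    MeasurableSpace.generateFrom_measurableSet (IsPiSystem.pi fun _ => hpi)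
    MeasurableSpace.isPiSystem_measurableSet (Measure.FiniteSpanningSetsIn.pi fun _ => hspan)
    (Measure.toFiniteSpanningSetsIn _) ?_
  rintro _ ⟨s, hs, rfl⟩ t ht
  rw [Measure.pi_pi, h s (fun j => (hs j trivial).1) (fun j => (hs j trivial).2) t ht]

section Mecke

variable {Ω : Type*} [MeasurableSpace Ω] {P : Measure Ω} {Y : ℕ → Ω → ℝ}

/-- Sends `ω` to the points of `Y` with the indices `i` and the sum of `f` over the other points. -/
def pointsAndRest (Y : ℕ → Ω → ℝ) (f : ℝ → ℝ≥0∞) {k : ℕ} (i : Fin k → ℕ) (ω : Ω) :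
    (Fin k → ℝ) × ℝ≥0∞ :=
  (fun j => Y (i j) ω, ∑' l : ↥(Set.range i)ᶜ, f (Y l ω))

lemma measurable_pointsAndRest (hY : ∀ i, Measurable (Y i)) {f : ℝ → ℝ≥0∞} (hf : Measurable f)
    {k : ℕ} (i : Fin k → ℕ) : Measurable (pointsAndRest Y f i) :=
  (measurable_pi_lambda _ fun j => hY (i j)).prodMk
    (Measurable.tsum fun l => hf.comp (hY l))

lemma lintegral_sum_map_pointsAndRest (hY : ∀ i, Measurable (Y i)) {f : ℝ → ℝ≥0∞}
    (hf : Measurable f) {k : ℕ} {G : (Fin k → ℝ) × ℝ≥0∞ → ℝ≥0∞} (hG : Measurable G) :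
    ∫⁻ z, G z ∂(Measure.sum fun i : Fin k ↪ ℕ => P.map (pointsAndRest Y f i)) =
      ∫⁻ ω, ∑' i : Fin k ↪ ℕ, G (pointsAndRest Y f i ω) ∂P := by
  have : Countable (Fin k ↪ ℕ) := DFunLike.coe_injective.countable
  have hmeas (i : Fin k ↪ ℕ) := measurable_pointsAndRest hY hf i
  rw [lintegral_sum_measure, lintegral_tsum fun i => by exact (hG.comp (hmeas i)).aemeasurable]
  exact tsum_congr fun i => lintegral_map hG (hmeas i)

lemma indicator_preimage_fst_pi {ι E F : Type*} [Fintype ι] (s : ι → Set E) (g : F → ℝ≥0∞)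
    (z : (ι → E) × F) :
    (Prod.fst ⁻¹' Set.pi Set.univ s).indicator (fun z => g z.2) z =
      (∏ j, (s j).indicator 1 (z.1 j)) * g z.2 := by
  classical
  simp only [Set.indicator_apply, Set.mem_preimage, Set.mem_univ_pi, Pi.one_apply,
    Finset.prod_ite_zero, Finset.prod_const_one, Finset.mem_univ, true_imp_iff, ite_mul, one_mul,
    zero_mul]

variable [IsProbabilityMeasure P] {Λ : Measure ℝ} [SigmaFinite Λ]

namespace IsPoissonProcess

lemma map_snd_restrict_sum_map_pointsAndRest (hY : IsPoissonProcess P Λ Y) {f : ℝ → ℝ≥0∞}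
    (hf : Measurable f) (hf_top : ∀ y, f y ≠ ∞) {k : ℕ} {s : Fin k → Set ℝ}
    (hs : ∀ j, MeasurableSet (s j)) (hsΛ : ∀ j, Λ (s j) ≠ ∞) :
    ((Measure.sum fun i : Fin k ↪ ℕ => P.map (pointsAndRest Y f i)).restrict
        (Prod.fst ⁻¹' Set.pi Set.univ s)).map Prod.snd =
      (∏ j, Λ (s j)) • P.map fun ω => ∑' l, f (Y l ω) := by
  have hsum : Measurable fun ω => ∑' l, f (Y l ω) :=
    Measurable.tsum fun l => hf.comp (hY.measurable l)
  have hpre : MeasurableSet (Prod.fst ⁻¹' Set.pi Set.univ s : Set ((Fin k → ℝ) × ℝ≥0∞)) :=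
    measurable_fst (MeasurableSet.univ_pi hs)
  set M := Measure.sum fun i : Fin k ↪ ℕ => P.map (pointsAndRest Y f i)
  have hlaplace (n : ℕ) :
      ∫⁻ x, negExp (n * x) ∂((M.restrict (Prod.fst ⁻¹' Set.pi Set.univ s)).map Prod.snd) =
        (∏ j, Λ (s j)) * ∫⁻ x, negExp (n * x) ∂(P.map fun ω => ∑' l, f (Y l ω)) := by
    have hone (j) : ∫⁻ y, (s j).indicator 1 y ∂Λ = Λ (s j) := lintegral_indicator_one (hs j)
    have hmecke := hY.lintegral_tsum_embedding (g := fun j => (s j).indicator 1)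
      (fun j => measurable_one.indicator (hs j))
      (fun j y => by by_cases hy : y ∈ s j <;> simp [hy])
      (fun j => by rw [hone]; exact hsΛ j) (f := fun y => n * f y) (by fun_prop)
      fun y => ENNReal.mul_ne_top (by simp) (hf_top y)
    simp_rw [hone] at hmecke
    rw [lintegral_map (by fun_prop) measurable_snd, ← lintegral_indicator hpre,
      lintegral_sum_map_pointsAndRest hY.measurable hf (Measurable.indicator (by fun_prop) hpre),
      lintegral_map (by fun_prop) hsum]
    simp_rw [indicator_preimage_fst_pi s fun x => negExp (n * x), pointsAndRest,
      ← ENNReal.tsum_mul_left (a := (n : ℝ≥0∞))]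
    rw [hY.lintegral_negExp (f := fun y => n * f y) (by fun_prop), ← hmecke]
  have hmass : IsFiniteMeasure ((M.restrict (Prod.fst ⁻¹' Set.pi Set.univ s)).map Prod.snd) := by
    have h0 := hlaplace 0
    have := Measure.isProbabilityMeasure_map (μ := P) hsum.aemeasurable
    simp only [Nat.cast_zero, zero_mul, negExp_zero, lintegral_one, measure_univ, mul_one] at h0
    exact ⟨h0 ▸ ENNReal.prod_lt_top fun j _ => (hsΛ j).lt_top⟩
  have := Measure.isProbabilityMeasure_map (μ := P) hsum.aemeasurable
  have : IsFiniteMeasure ((∏ j, Λ (s j)) • P.map fun ω => ∑' l, f (Y l ω)) :=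
    ⟨by simpa using ENNReal.prod_lt_top fun j _ => (hsΛ j).lt_top⟩
  exact ext_of_lintegral_negExp fun n => by rw [hlaplace, lintegral_smul_measure, smul_eq_mul]

theorem sum_map_pointsAndRest (hY : IsPoissonProcess P Λ Y) {f : ℝ → ℝ≥0∞} (hf : Measurable f)
    (hf_top : ∀ y, f y ≠ ∞) (k : ℕ) :
    Measure.sum (fun i : Fin k ↪ ℕ => P.map (pointsAndRest Y f i)) =
      (Measure.pi fun _ => Λ).prod (P.map fun ω => ∑' l, f (Y l ω)) := by
  have hsum : Measurable fun ω => ∑' l, f (Y l ω) :=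
    Measurable.tsum fun l => hf.comp (hY.measurable l)
  have := Measure.isProbabilityMeasure_map (μ := P) hsum.aemeasurable
  refine (pi_prod_eq_of_rectangles fun s hs hsΛ t ht => ?_).symm
  rw [← smul_eq_mul, ← Measure.smul_apply,
    ← hY.map_snd_restrict_sum_map_pointsAndRest hf hf_top hs hsΛ,
    Measure.map_apply measurable_snd ht, Measure.restrict_apply (measurable_snd ht),
    Set.prod_eq, Set.inter_comm]

end IsPoissonProcess

end Mecke

/-! ### Gamma and Beta distributions -/

@[simp] lemma rising_zero (a : ℝ) : rising a 0 = 1 := by simp [rising]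

lemma rising_succ (a : ℝ) (k : ℕ) : rising a (k + 1) = rising a k * (a + k) :=
  ascPochhammer_succ_eval k a

lemma rising_pos {a : ℝ} (ha : 0 < a) (k : ℕ) : 0 < rising a k := ascPochhammer_pos k a ha

lemma Gamma_add_natCast {a : ℝ} (ha : 0 < a) (k : ℕ) :
    Real.Gamma (a + k) = rising a k * Real.Gamma a := by
  induction k with
  | zero => simp
  | succ k ih =>
    rw [Nat.cast_succ, ← add_assoc, Real.Gamma_add_one (by positivity), ih, rising_succ]
    ring

lemma measurable_gammaPDF (a r : ℝ) : Measurable (gammaPDF a r) :=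
  (measurable_gammaPDFReal a r).ennreal_ofReal

lemma measurable_betaPDF (α β : ℝ) : Measurable (betaPDF α β) :=
  (measurable_betaPDFReal α β).ennreal_ofReal

instance nullSingletonClass_gammaMeasure (a r : ℝ) : NullSingletonClass (gammaMeasure a r) := by
  unfold gammaMeasure
  infer_instance

instance nullSingletonClass_betaMeasure (α β : ℝ) : NullSingletonClass (betaMeasure α β) := by
  unfold betaMeasure
  infer_instance

lemma ae_pos_gammaMeasure (a r : ℝ) : ∀ᵐ x ∂(gammaMeasure a r), 0 < x := by
  rw [gammaMeasure, ae_withDensity_iff (measurable_gammaPDF a r)]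
  filter_upwards [Measure.ae_ne volume (0 : ℝ)] with x hx hpdf
  exact (not_lt.1 fun h => hpdf (gammaPDF_of_neg h)).lt_of_ne' hx

lemma ae_mem_Ioo_betaMeasure (α β : ℝ) : ∀ᵐ v ∂(betaMeasure α β), v ∈ Set.Ioo (0 : ℝ) 1 := by
  rw [betaMeasure, ae_withDensity_iff (measurable_betaPDF α β)]
  exact .of_forall fun v hpdf => ⟨not_le.1 fun h => hpdf (betaPDF_eq_zero_of_nonpos h),
    not_le.1 fun h => hpdf (betaPDF_eq_zero_of_one_le h)⟩

lemma gammaMeasure_withDensity_pow {a r : ℝ} (ha : 0 < a) (hr : 0 < r) (k : ℕ) :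
    (gammaMeasure a r).withDensity (fun x => ENNReal.ofReal (x ^ k))
      = ENNReal.ofReal (rising a k / r ^ k) • gammaMeasure (a + k) r := by
  rw [gammaMeasure, gammaMeasure, ← withDensity_mul _ (measurable_gammaPDF a r) (by fun_prop),
    ← withDensity_smul _ (measurable_gammaPDF (a + k) r)]
  refine withDensity_congr_ae ?_
  filter_upwards [Measure.ae_ne volume (0 : ℝ)] with x hx
  rcases lt_or_gt_of_ne hx with hx | hx
  · simp [gammaPDF_of_neg hx]
  · have := Real.Gamma_pos_of_pos ha
    have := rising_pos ha k
    simp only [Pi.mul_apply, Pi.smul_apply, smul_eq_mul]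
    rw [gammaPDF_of_nonneg hx.le, gammaPDF_of_nonneg hx.le, mul_comm,
      ← ENNReal.ofReal_mul (by positivity), ← ENNReal.ofReal_mul (by positivity),
      Gamma_add_natCast ha, add_sub_right_comm, Real.rpow_add_natCast hx.ne',
      Real.rpow_add_natCast hr.ne']
    congr 1
    field_simp

lemma betaMeasure_withDensity_one_sub_pow {α β : ℝ} (hα : 0 < α) (hβ : 0 < β) (k : ℕ) :
    (betaMeasure α β).withDensity (fun v => ENNReal.ofReal ((1 - v) ^ k))
      = ENNReal.ofReal (rising β k / rising (α + β) k) • betaMeasure α (β + k) := by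
  rw [betaMeasure, betaMeasure, ← withDensity_mul _ (measurable_betaPDF α β) (by fun_prop),
    ← withDensity_smul _ (measurable_betaPDF α (β + k))]
  congr 1
  ext v
  simp only [Pi.mul_apply, Pi.smul_apply, smul_eq_mul]
  rcases le_or_gt v 0 with hv0 | hv0
  · simp [betaPDF_eq_zero_of_nonpos hv0]
  rcases le_or_gt 1 v with hv1 | hv1
  · simp [betaPDF_eq_zero_of_one_le hv1]
  have hv : 0 < 1 - v := sub_pos.2 hv1
  have := beta_pos hα hβ
  have := rising_pos hβ k
  have := rising_pos (add_pos hα hβ) k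
  have := (Real.Gamma_pos_of_pos hα).ne'
  have := (Real.Gamma_pos_of_pos hβ).ne'
  have := (Real.Gamma_pos_of_pos (add_pos hα hβ)).ne'
  rw [betaPDF_of_pos_lt_one hv0 hv1, betaPDF_of_pos_lt_one hv0 hv1, mul_comm,
    ← ENNReal.ofReal_mul (by positivity), ← ENNReal.ofReal_mul (by positivity), beta, beta,
    ← add_assoc, Gamma_add_natCast hβ, Gamma_add_natCast (add_pos hα hβ), add_sub_right_comm,
    Real.rpow_add_natCast hv.ne']
  congr 1
  field_simp

lemma integral_pow_mul_gammaMeasure {a r : ℝ} (ha : 0 < a) (hr : 0 < r) (k : ℕ) (f : ℝ → ℝ) :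
    ∫ x, x ^ k * f x ∂(gammaMeasure a r)
      = rising a k / r ^ k * ∫ x, f x ∂(gammaMeasure (a + k) r) := by
  have hk := rising_pos ha k
  calc ∫ x, x ^ k * f x ∂(gammaMeasure a r)
      = ∫ x, (ENNReal.ofReal (x ^ k)).toReal • f x ∂(gammaMeasure a r) := by
        refine integral_congr_ae ?_
        filter_upwards [ae_pos_gammaMeasure a r] with x hx
        rw [ENNReal.toReal_ofReal (by positivity), smul_eq_mul]
    _ = ∫ x, f x ∂((gammaMeasure a r).withDensity fun x => ENNReal.ofReal (x ^ k)) :=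
        (integral_withDensity_eq_integral_toReal_smul (by fun_prop) (by simp) f).symm
    _ = rising a k / r ^ k * ∫ x, f x ∂(gammaMeasure (a + k) r) := by
        rw [gammaMeasure_withDensity_pow ha hr, integral_smul_measure,
          ENNReal.toReal_ofReal (by positivity), smul_eq_mul]

lemma integral_one_sub_pow_mul_betaMeasure {α β : ℝ} (hα : 0 < α) (hβ : 0 < β) (k : ℕ)
    (f : ℝ → ℝ) :
    ∫ v, (1 - v) ^ k * f v ∂(betaMeasure α β)
      = rising β k / rising (α + β) k * ∫ v, f v ∂(betaMeasure α (β + k)) := by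
  have hk := rising_pos hβ k
  have hk' := rising_pos (add_pos hα hβ) k
  calc ∫ v, (1 - v) ^ k * f v ∂(betaMeasure α β)
      = ∫ v, (ENNReal.ofReal ((1 - v) ^ k)).toReal • f v ∂(betaMeasure α β) := by
        refine integral_congr_ae ?_
        filter_upwards [ae_mem_Ioo_betaMeasure α β] with v hv
        rw [ENNReal.toReal_ofReal (pow_nonneg (sub_nonneg.2 hv.2.le) k), smul_eq_mul]
    _ = ∫ v, f v ∂((betaMeasure α β).withDensity fun v => ENNReal.ofReal ((1 - v) ^ k)) :=
        (integral_withDensity_eq_integral_toReal_smul (by fun_prop) (by simp) f).symm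
    _ = rising β k / rising (α + β) k * ∫ v, f v ∂(betaMeasure α (β + k)) := by
        rw [betaMeasure_withDensity_one_sub_pow hα hβ, integral_smul_measure,
          ENNReal.toReal_ofReal (by positivity), smul_eq_mul]

lemma lintegral_exp_neg_mul_gammaMeasure {a r s : ℝ} (ha : 0 < a) (hr : 0 < r) (hs : 0 ≤ s) :
    ∫⁻ x, ENNReal.ofReal (Real.exp (-(s * x))) ∂(gammaMeasure a r)
      = ENNReal.ofReal ((r / (r + s)) ^ a) := by
  have hrs : 0 < r + s := by positivity
  have hpdf (x : ℝ) : gammaPDF a r x * ENNReal.ofReal (Real.exp (-(s * x)))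
      = ENNReal.ofReal ((r / (r + s)) ^ a) * gammaPDF a (r + s) x := by
    rcases lt_or_ge x 0 with hx | hx
    · simp [gammaPDF_of_neg hx]
    have := Real.Gamma_pos_of_pos ha
    rw [gammaPDF_of_nonneg hx, gammaPDF_of_nonneg hx, ← ENNReal.ofReal_mul (by positivity),
      ← ENNReal.ofReal_mul (by positivity), Real.div_rpow hr.le hrs.le, add_mul, neg_add,
      Real.exp_add]
    congr 1
    field_simp
  rw [gammaMeasure, lintegral_withDensity_eq_lintegral_mul _ (measurable_gammaPDF a r)
    (by fun_prop)]
  simp only [Pi.mul_apply, hpdf]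
  rw [lintegral_const_mul _ (measurable_gammaPDF a (r + s)), lintegral_gammaPDF_eq_one ha hrs,
    mul_one]

lemma integrable_pow_gammaMeasure {a r : ℝ} (ha : 0 < a) (hr : 0 < r) (k : ℕ) :
    Integrable (fun x => x ^ k) (gammaMeasure a r) := by
  have hk : 0 < a + k := by positivity
  have := isProbabilityMeasure_gammaMeasure hk hr
  have hone : Integrable (fun _ => (1 : ℝ))
      ((gammaMeasure a r).withDensity fun x => ENNReal.ofReal (x ^ k)) := by
    rw [gammaMeasure_withDensity_pow ha hr]
    exact (integrable_const 1).smul_measure ENNReal.ofReal_ne_top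
  rw [integrable_withDensity_iff_integrable_smul' (by fun_prop) (by simp)] at hone
  refine hone.congr ?_
  filter_upwards [ae_pos_gammaMeasure a r] with x hx
  rw [ENNReal.toReal_ofReal (by positivity), smul_eq_mul, mul_one]

lemma integrable_eval_gammaMeasure {a r : ℝ} (ha : 0 < a) (hr : 0 < r) (p : ℝ[X]) :
    Integrable (fun x => p.eval x) (gammaMeasure a r) := by
  simp_rw [eval_eq_sum_range]
  exact integrable_finsetSum _ fun k _ => (integrable_pow_gammaMeasure ha hr k).const_mul _

lemma integrable_betaMeasure_of_continuous {α β : ℝ} (hα : 0 < α) (hβ : 0 < β) {f : ℝ → ℝ}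
    (hf : Continuous f) : Integrable f (betaMeasure α β) := by
  have := isProbabilityMeasureBeta hα hβ
  rw [← Measure.restrict_eq_self_of_ae_mem (s := Set.Icc (0 : ℝ) 1)
    ((ae_mem_Ioo_betaMeasure α β).mono fun v hv => Set.Ioo_subset_Icc_self hv)]
  exact hf.integrableOn_Icc

lemma lintegral_gammaMeasure (a r : ℝ) {f : ℝ → ℝ≥0∞} (hf : Measurable f) :
    ∫⁻ x, f x ∂(gammaMeasure a r) = ∫⁻ x, gammaPDF a r x * f x :=
  lintegral_withDensity_eq_lintegral_mul _ (measurable_gammaPDF a r) hf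

lemma lintegral_betaMeasure (α β : ℝ) {f : ℝ → ℝ≥0∞} (hf : Measurable f) :
    ∫⁻ v, f v ∂(betaMeasure α β) = ∫⁻ v, betaPDF α β v * f v :=
  lintegral_withDensity_eq_lintegral_mul _ (measurable_betaPDF α β) hf

lemma lintegral_comp_mul_left {t : ℝ} (ht : 0 < t) {f : ℝ → ℝ≥0∞} (hf : Measurable f) :
    ∫⁻ x, f x = ENNReal.ofReal t * ∫⁻ v, f (t * v) := by
  conv_lhs => rw [← Real.smul_map_volume_mul_left ht.ne']
  rw [lintegral_smul_measure, lintegral_map hf (by fun_prop), abs_of_pos ht, smul_eq_mul]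

lemma gammaPDF_mul_gammaPDF {a b r t v : ℝ} (ha : 0 < a) (hb : 0 < b) (hr : 0 < r) (ht : 0 < t)
    (hv0 : v ≠ 0) (hv1 : v ≠ 1) :
    ENNReal.ofReal t * (gammaPDF a r (t * v) * gammaPDF b r (t - t * v))
      = gammaPDF (a + b) r t * betaPDF a b v := by
  rcases lt_or_gt_of_ne hv0 with hv0 | hv0
  · rw [gammaPDF_of_neg (mul_neg_of_pos_of_neg ht hv0), betaPDF_eq_zero_of_nonpos hv0.le]
    simp
  rcases lt_or_gt_of_ne hv1.symm with hv1 | hv1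
  · rw [gammaPDF_of_neg (x := t - t * v) (by nlinarith), betaPDF_eq_zero_of_one_le hv1.le]
    simp
  have hv : 0 < 1 - v := sub_pos.2 hv1
  have htv : t - t * v = t * (1 - v) := by ring
  have := Real.Gamma_pos_of_pos ha
  have := Real.Gamma_pos_of_pos hb
  have := Real.Gamma_pos_of_pos (add_pos ha hb)
  rw [htv, gammaPDF_of_nonneg (by positivity), gammaPDF_of_nonneg (by positivity),
    gammaPDF_of_nonneg ht.le, betaPDF_of_pos_lt_one hv0 hv1, ← ENNReal.ofReal_mul (by positivity),
    ← ENNReal.ofReal_mul ht.le, ← ENNReal.ofReal_mul (by positivity), beta,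
    Real.mul_rpow ht.le hv0.le, Real.mul_rpow ht.le hv.le,
    show -(r * t) = -(r * (t * v)) + -(r * (t * (1 - v))) by ring, Real.exp_add,
    Real.rpow_add hr, show a + b - 1 = (a - 1) + (b - 1) + 1 by ring, Real.rpow_add_one ht.ne',
    Real.rpow_add ht]
  congr 1
  field_simp

theorem lintegral_gammaMeasure_gammaMeasure {a b r : ℝ} (ha : 0 < a) (hb : 0 < b) (hr : 0 < r)
    {G : ℝ × ℝ → ℝ≥0∞} (hG : Measurable G) :
    ∫⁻ x, ∫⁻ w, G (x + w, x / (x + w)) ∂(gammaMeasure b r) ∂(gammaMeasure a r)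
      = ∫⁻ t, ∫⁻ v, G (t, v) ∂(betaMeasure a b) ∂(gammaMeasure (a + b) r) := by
  have := isProbabilityMeasure_gammaMeasure hb hr
  have := isProbabilityMeasureBeta ha hb
  have hpa := measurable_gammaPDF a r
  have hpb := measurable_gammaPDF b r
  have hβ := measurable_betaPDF a b
  have shift (x : ℝ) : gammaPDF a r x * ∫⁻ w, G (x + w, x / (x + w)) ∂(gammaMeasure b r)
      = ∫⁻ t, gammaPDF a r x * gammaPDF b r (t - x) * G (t, x / t) := by
    rw [lintegral_gammaMeasure b r (by fun_prop), ← lintegral_const_mul _ (by fun_prop),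
      ← lintegral_sub_right_eq_self _ x]
    simp only [add_sub_cancel, mul_assoc]
  have scale (t : ℝ) (ht : t ≠ 0) :
      ∫⁻ x, gammaPDF a r x * gammaPDF b r (t - x) * G (t, x / t)
        = gammaPDF (a + b) r t * ∫⁻ v, G (t, v) ∂(betaMeasure a b) := by
    rcases lt_or_gt_of_ne ht with ht | ht
    · rw [gammaPDF_of_neg ht, zero_mul]
      refine (lintegral_congr fun x => ?_).trans lintegral_zero
      rcases lt_or_ge x 0 with hx | hx
      · rw [gammaPDF_of_neg hx, zero_mul, zero_mul]
      · rw [gammaPDF_of_neg (x := t - x) (by linarith), mul_zero, zero_mul]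
    · rw [lintegral_comp_mul_left ht (by fun_prop), lintegral_betaMeasure a b (by fun_prop),
        ← lintegral_const_mul _ (by fun_prop), ← lintegral_const_mul _ (by fun_prop)]
      refine lintegral_congr_ae ?_
      filter_upwards [Measure.ae_ne volume (0 : ℝ), Measure.ae_ne volume (1 : ℝ)] with v hv0 hv1
      rw [← mul_assoc, gammaPDF_mul_gammaPDF ha hb hr ht hv0 hv1, mul_div_cancel_left₀ v ht.ne',
        mul_assoc]
  rw [lintegral_gammaMeasure a r (Measurable.lintegral_prod_right' (f := fun p : ℝ × ℝ =>
      G (p.1 + p.2, p.1 / (p.1 + p.2))) (by fun_prop)),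
    lintegral_gammaMeasure (a + b) r (Measurable.lintegral_prod_right' hG)]
  simp only [shift]
  rw [lintegral_lintegral_swap (by fun_prop)]
  exact lintegral_congr_ae ((Measure.ae_ne volume (0 : ℝ)).mono scale)

/-! ### The intensity measure and the law of the total mass -/

lemma lintegral_gammaIntensity (θ : ℝ) {f : ℝ → ℝ≥0∞} (hf : Measurable f) :
    ∫⁻ y, f y ∂(gammaIntensity θ)
      = ∫⁻ y in Set.Ioi 0, ENNReal.ofReal (θ * y⁻¹ * Real.exp (-y)) * f y := by
  rw [gammaIntensity, lintegral_withDensity_eq_lintegral_mul _ (by fun_prop) hf]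
  rfl

instance sigmaFinite_gammaIntensity (θ : ℝ) : SigmaFinite (gammaIntensity θ) := by
  unfold gammaIntensity
  exact SigmaFinite.withDensity_ofReal _

lemma gammaIntensity_Iic_zero (θ : ℝ) : gammaIntensity θ (Set.Iic 0) = 0 := by
  refine withDensity_absolutelyContinuous _ _ ?_
  rw [Measure.restrict_apply measurableSet_Iic, Set.Iic_inter_Ioi, Set.Ioc_self, measure_empty]

lemma lintegral_ofReal_mul_gammaIntensity {θ : ℝ} (hθ : 0 ≤ θ) {f : ℝ → ℝ≥0∞}
    (hf : Measurable f) :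
    ∫⁻ y, ENNReal.ofReal y * f y ∂(gammaIntensity θ)
      = ENNReal.ofReal θ * ∫⁻ y, f y ∂(gammaMeasure 1 1) := by
  have hgamma : gammaMeasure 1 1
      = (volume.restrict (Set.Ioi 0)).withDensity fun y => ENNReal.ofReal (Real.exp (-y)) := by
    rw [← withDensity_indicator measurableSet_Ioi, gammaMeasure]
    refine withDensity_congr_ae ?_
    filter_upwards [Measure.ae_ne volume (0 : ℝ)] with y hy
    rcases lt_or_gt_of_ne hy with hy | hy
    · rw [gammaPDF_of_neg hy, Set.indicator_of_notMem (by simpa using hy.le)]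
    · rw [gammaPDF_of_nonneg hy.le, Set.indicator_of_mem (by exact hy)]
      simp
  rw [lintegral_gammaIntensity θ (by fun_prop), hgamma,
    lintegral_withDensity_eq_lintegral_mul _ (by fun_prop) hf,
    ← lintegral_const_mul _ (by fun_prop)]
  refine setLIntegral_congr_fun measurableSet_Ioi fun y (hy : 0 < y) => ?_
  simp only [Pi.mul_apply]
  rw [← mul_assoc, ← mul_assoc, ← ENNReal.ofReal_mul (by positivity), ← ENNReal.ofReal_mul hθ]
  congr 2
  field_simp

lemma integral_exp_neg_add_mul {y t : ℝ} (hy : y ≠ 0) :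
    ∫ s in (0 : ℝ)..t, Real.exp (-((1 + s) * y)) =
      y⁻¹ * Real.exp (-y) * (1 - Real.exp (-(t * y))) := by
  have hderiv (s : ℝ) : HasDerivAt (fun s => -(y⁻¹ * Real.exp (-((1 + s) * y))))
      (Real.exp (-((1 + s) * y))) s := by
    convert! ((((((hasDerivAt_id s).const_add 1).mul_const y).neg).exp).const_mul y⁻¹).neg using 1
    field_simp
    simp [mul_comm]
  rw [intervalIntegral.integral_eq_sub_of_hasDerivAt (fun s _ => hderiv s)
    (Continuous.intervalIntegrable (by fun_prop) _ _), add_mul, neg_add, Real.exp_add]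
  simp only [one_mul, add_zero]
  ring

lemma integral_inv_one_add {t : ℝ} (ht : 0 ≤ t) :
    ∫ s in (0 : ℝ)..t, (1 + s)⁻¹ = Real.log (1 + t) := by
  rw [intervalIntegral.integral_comp_add_left (fun s => s⁻¹),
    integral_inv_of_pos (by norm_num) (by positivity)]
  simp

/-- Frullani's integral. -/
theorem lintegral_one_sub_exp_gammaIntensity {θ t : ℝ} (hθ : 0 ≤ θ) (ht : 0 ≤ t) :
    ∫⁻ y, ENNReal.ofReal (1 - Real.exp (-(t * y))) ∂(gammaIntensity θ)
      = ENNReal.ofReal (θ * Real.log (1 + t)) := by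
  have inner (y : ℝ) (hy : 0 < y) :
      ENNReal.ofReal (θ * y⁻¹ * Real.exp (-y)) * ENNReal.ofReal (1 - Real.exp (-(t * y)))
        = ENNReal.ofReal θ * ∫⁻ s in Set.Ioc 0 t, ENNReal.ofReal (Real.exp (-((1 + s) * y))) := by
    rw [← ofReal_integral_eq_lintegral_ofReal (Continuous.integrableOn_Ioc (by fun_prop))
        (.of_forall fun s => (Real.exp_pos _).le), ← intervalIntegral.integral_of_le ht,
      integral_exp_neg_add_mul hy.ne', ← ENNReal.ofReal_mul hθ,
      ← ENNReal.ofReal_mul (by positivity)]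
    congr 1
    ring
  have outer (s : ℝ) (hs : s ∈ Set.Ioc 0 t) :
      ∫⁻ y in Set.Ioi 0, ENNReal.ofReal (Real.exp (-((1 + s) * y))) = ENNReal.ofReal (1 + s)⁻¹ := by
    have hs : -(1 + s) < 0 := by linarith [hs.1]
    simp_rw [← neg_mul]
    rw [← ofReal_integral_eq_lintegral_ofReal (integrableOn_exp_mul_Ioi hs 0)
      (.of_forall fun y => (Real.exp_pos _).le), integral_exp_mul_Ioi hs 0,
      mul_zero, Real.exp_zero, neg_div_neg_eq, one_div]
  have hcont : ContinuousOn (fun s : ℝ => (1 + s)⁻¹) (Set.Icc 0 t) :=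
    ContinuousOn.inv₀ (by fun_prop) fun s hs => by linarith [hs.1]
  rw [lintegral_gammaIntensity θ (by fun_prop), setLIntegral_congr_fun measurableSet_Ioi inner,
    lintegral_const_mul _ (by fun_prop), lintegral_lintegral_swap (by fun_prop),
    setLIntegral_congr_fun measurableSet_Ioc outer,
    ← ofReal_integral_eq_lintegral_ofReal (hcont.integrableOn_Icc.mono_set Set.Ioc_subset_Icc_self)
      ((ae_restrict_iff' measurableSet_Ioc).2 <| .of_forall fun s hs =>
        inv_nonneg.2 (by linarith [hs.1])),
    ← intervalIntegral.integral_of_le ht, integral_inv_one_add ht, ENNReal.ofReal_mul hθ]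

namespace IsPoissonProcess

variable {Ω : Type*} [MeasurableSpace Ω] {P : Measure Ω} [IsProbabilityMeasure P]
  {Y : ℕ → Ω → ℝ}

/-- Campbell's formula. -/
theorem lintegral_tsum {Λ : Measure ℝ} [SigmaFinite Λ] (hY : IsPoissonProcess P Λ Y)
    {g : ℝ → ℝ≥0∞} (hg : Measurable g) :
    ∫⁻ ω, ∑' i, g (Y i ω) ∂P = ∫⁻ y, g y ∂Λ := by
  have h := lintegral_sum_map_pointsAndRest (P := P) hY.measurable (f := 0) measurable_zero
    (k := 1) (G := fun z => g (z.1 0)) (by fun_prop)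
  rw [hY.sum_map_pointsAndRest measurable_zero (by simp), lintegral_prod _ (by fun_prop)] at h
  simp only [Pi.zero_apply, tsum_zero, lintegral_const, Measure.map_const, pointsAndRest,
    measure_univ, one_smul, mul_one] at h
  calc ∫⁻ ω, ∑' i, g (Y i ω) ∂P
      = ∫⁻ ω, ∑' i : Fin 1 ↪ ℕ, g (Y (i 0) ω) ∂P :=
        lintegral_congr fun ω => (Equiv.uniqueEmbeddingEquivResult.tsum_eq fun i => g (Y i ω)).symm
    _ = ∫⁻ x : Fin 1 → ℝ, g (x 0) ∂(Measure.pi fun _ => Λ) := h.symm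
    _ = ∫⁻ y, g y ∂Λ := (measurePreserving_funUnique Λ (Fin 1)).lintegral_comp hg

lemma ae_forall_notMem {Λ : Measure ℝ} [SigmaFinite Λ] (hY : IsPoissonProcess P Λ Y)
    {s : Set ℝ} (hs : MeasurableSet s) (hΛ : Λ s = 0) : ∀ᵐ ω ∂P, ∀ i, Y i ω ∉ s := by
  have h := hY.lintegral_tsum (measurable_one.indicator hs)
  rw [lintegral_indicator_one hs, hΛ, lintegral_eq_zero_iff
    (Measurable.tsum fun i => by exact (measurable_one.indicator hs).comp (hY.measurable i))] at h
  filter_upwards [h] with ω hω i hi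
  have h1 := ENNReal.tsum_eq_zero.1 hω i
  simp [hi] at h1

variable {θ : ℝ}

lemma ae_pos (hY : IsPoissonProcess P (gammaIntensity θ) Y) : ∀ᵐ ω ∂P, ∀ i, 0 < Y i ω := by
  simpa using hY.ae_forall_notMem measurableSet_Iic (gammaIntensity_Iic_zero θ)

lemma map_tsum_ofReal (hθ : 0 < θ) (hY : IsPoissonProcess P (gammaIntensity θ) Y) :
    P.map (fun ω => ∑' i, ENNReal.ofReal (Y i ω)) = (gammaMeasure θ 1).map ENNReal.ofReal := by
  have := isProbabilityMeasure_gammaMeasure hθ one_pos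
  have hsum : Measurable fun ω => ∑' i, ENNReal.ofReal (Y i ω) :=
    Measurable.tsum fun i => (hY.measurable i).ennreal_ofReal
  have := Measure.isProbabilityMeasure_map hsum.aemeasurable (μ := P)
  have := Measure.isProbabilityMeasure_map ENNReal.measurable_ofReal.aemeasurable
    (μ := gammaMeasure θ 1)
  have hn (n : ℕ) {x : ℝ} : (n : ℝ≥0∞) * ENNReal.ofReal x = ENNReal.ofReal (n * x) := by
    rw [ENNReal.ofReal_mul n.cast_nonneg, ENNReal.ofReal_natCast]
  refine ext_of_lintegral_negExp fun n => ?_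
  calc ∫⁻ x, negExp (n * x) ∂(P.map fun ω => ∑' i, ENNReal.ofReal (Y i ω))
      = ∫⁻ ω, negExp (∑' i, n * ENNReal.ofReal (Y i ω)) ∂P := by
        rw [lintegral_map (by fun_prop) hsum]
        simp only [ENNReal.tsum_mul_left]
    _ = negExp (∫⁻ y, 1 - negExp (n * ENNReal.ofReal y) ∂(gammaIntensity θ)) :=
        hY.lintegral_negExp (f := fun y => n * ENNReal.ofReal y) (by fun_prop)
    _ = negExp (∫⁻ y, ENNReal.ofReal (1 - Real.exp (-(n * y))) ∂(gammaIntensity θ)) := by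
        congr 1
        refine lintegral_congr_ae ?_
        filter_upwards [measure_eq_zero_iff_ae_notMem.1 (gammaIntensity_Iic_zero θ)] with y hy
        have hy : 0 < y := not_le.1 hy
        rw [hn, negExp_ofReal (by positivity), ENNReal.ofReal_sub _ (Real.exp_pos _).le,
          ENNReal.ofReal_one]
    _ = ENNReal.ofReal ((1 / (1 + n)) ^ θ) := by
        have hlog : 0 ≤ Real.log (1 + n) := Real.log_nonneg (by simp)
        rw [lintegral_one_sub_exp_gammaIntensity hθ.le n.cast_nonneg,
          negExp_ofReal (by positivity), one_div, Real.inv_rpow (by positivity),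
          ← Real.rpow_neg (by positivity), Real.rpow_def_of_pos (by positivity)]
        ring_nf
    _ = ∫⁻ x, negExp (n * x) ∂((gammaMeasure θ 1).map ENNReal.ofReal) := by
        rw [lintegral_map (by fun_prop) (by fun_prop),
          ← lintegral_exp_neg_mul_gammaMeasure hθ one_pos n.cast_nonneg]
        refine lintegral_congr_ae ?_
        filter_upwards [ae_pos_gammaMeasure θ 1] with x hx
        rw [hn, negExp_ofReal (by positivity)]

lemma ae_summable (hθ : 0 < θ) (hY : IsPoissonProcess P (gammaIntensity θ) Y) :
    ∀ᵐ ω ∂P, Summable fun i => Y i ω := by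
  have hsum : Measurable fun ω => ∑' i, ENNReal.ofReal (Y i ω) :=
    Measurable.tsum fun i => (hY.measurable i).ennreal_ofReal
  have hfin : ∀ᵐ x ∂(P.map fun ω => ∑' i, ENNReal.ofReal (Y i ω)), x ≠ ∞ := by
    rw [hY.map_tsum_ofReal hθ]
    exact (ae_map_iff ENNReal.measurable_ofReal.aemeasurable
      (measurableSet_singleton ∞).compl).2 (.of_forall fun _ => ENNReal.ofReal_ne_top)
  filter_upwards [ae_of_ae_map hsum.aemeasurable hfin, hY.ae_pos] with ω hω hpos
  exact (ENNReal.summable_toReal hω).congr fun i => ENNReal.toReal_ofReal (hpos i).le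

/-- Mecke's formula. -/
theorem lintegral_tsum_gammaIntensity (hθ : 0 < θ)
    (hY : IsPoissonProcess P (gammaIntensity θ) Y) {k : ℕ} {F : (Fin k → ℝ) × ℝ → ℝ≥0∞}
    (hF : Measurable F) :
    ∫⁻ ω, ∑' i : Fin k ↪ ℕ,
        F (fun j => Y (i j) ω, (∑' l : ↥(Set.range i)ᶜ, ENNReal.ofReal (Y l ω)).toReal) ∂P
      = ∫⁻ x, ∫⁻ w, F (x, w) ∂(gammaMeasure θ 1) ∂(Measure.pi fun _ => gammaIntensity θ) := by
  have := isProbabilityMeasure_gammaMeasure hθ one_pos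
  have hG : Measurable fun z : (Fin k → ℝ) × ℝ≥0∞ => F (z.1, z.2.toReal) :=
    hF.comp (measurable_fst.prodMk measurable_snd.ennreal_toReal)
  have h := lintegral_sum_map_pointsAndRest (P := P) hY.measurable ENNReal.measurable_ofReal hG
  rw [hY.sum_map_pointsAndRest ENNReal.measurable_ofReal (by simp), hY.map_tsum_ofReal hθ,
    lintegral_prod _ hG.aemeasurable] at h
  refine h.symm.trans (lintegral_congr fun x => ?_)
  rw [lintegral_map (by exact hG.comp measurable_prodMk_left) (by fun_prop)]
  refine lintegral_congr_ae ?_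
  filter_upwards [ae_pos_gammaMeasure θ 1] with w hw
  rw [ENNReal.toReal_ofReal hw.le]

end IsPoissonProcess

/-! ### Stick breaking -/

/-- The relative sizes `x_j / (s - ∑_{i < j} x_i)` of pieces broken off one after the other from a
stick of length `s`. The pieces are numbered by `Fin k` or by `ℕ`. -/
def stick {ι : Type*} [Preorder ι] [LocallyFiniteOrderBot ι] (s : ℝ) (x : ι → ℝ) (j : ι) : ℝ :=
  x j / (s - ∑ i ∈ Finset.Iio j, x i)

@[fun_prop]
lemma measurable_stick {ι : Type*} [Preorder ι] [LocallyFiniteOrderBot ι] :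
    Measurable fun p : ℝ × (ι → ℝ) => stick p.1 p.2 := by
  unfold stick
  fun_prop

lemma stick_comp_val {k : ℕ} (s : ℝ) (x : ℕ → ℝ) (j : Fin k) :
    stick s (fun i : Fin k => x i) j = stick s x j := by
  rw [stick, stick, ← Fin.map_valEmbedding_Iio, Finset.sum_map]
  rfl

lemma stick_cons {k : ℕ} (s x₀ : ℝ) (x : Fin k → ℝ) :
    stick s (Fin.cons x₀ x : Fin (k + 1) → ℝ) = Fin.cons (x₀ / s) (stick (s - x₀) x) := by
  ext j
  cases j using Fin.cases with
  | zero => simp [stick, ← Finset.filter_gt_eq_Iio]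
  | succ j =>
    simp [stick, ← Finset.filter_gt_eq_Iio, Finset.sum_filter, Fin.sum_univ_succ, sub_sub]

lemma stick_nonneg {k : ℕ} {s : ℝ} {x : Fin k → ℝ} (hx : ∀ j, 0 ≤ x j) (hs : ∑ j, x j ≤ s)
    (j : Fin k) : 0 ≤ stick s x j :=
  div_nonneg (hx j) (sub_nonneg.2 ((Finset.sum_le_univ_sum_of_nonneg hx).trans hs))

lemma prod_one_sub_stick {s : ℝ} {x : ℕ → ℝ} (h : ∀ k, 0 < s - ∑ i ∈ Finset.range k, x i) (k : ℕ) :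
    ∏ i ∈ Finset.range k, (1 - stick s x i) = (s - ∑ i ∈ Finset.range k, x i) / s := by
  induction k with
  | zero => simpa using (div_self (by simpa using (h 0).ne')).symm
  | succ k ih =>
    have hk := (h k).ne'
    rw [Finset.prod_range_succ, ih, stick, Nat.Iio_eq_range, Finset.sum_range_succ]
    field_simp
    ring

lemma lintegral_pi_succ {k : ℕ} (μ : Measure ℝ) [SigmaFinite μ] {H : (Fin (k + 1) → ℝ) → ℝ≥0∞}
    (hH : Measurable H) :
    ∫⁻ x, H x ∂(Measure.pi fun _ => μ)
      = ∫⁻ x₀, ∫⁻ x, H (Fin.cons x₀ x) ∂(Measure.pi fun _ => μ) ∂μ := by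
  have h := measurePreserving_piFinSuccAbove (fun _ : Fin (k + 1) => μ) 0
  rw [← h.symm.lintegral_comp hH, lintegral_prod _ (by
    exact (hH.comp (MeasurableEquiv.measurable _)).aemeasurable)]
  simp [MeasurableEquiv.piFinSuccAbove, Fin.insertNthEquiv]

lemma lintegral_inv_mul_gammaMeasure {a : ℝ} (ha : 0 < a) {H : ℝ → ℝ≥0∞} (hH : Measurable H) :
    ENNReal.ofReal a * ∫⁻ t, ENNReal.ofReal t⁻¹ * H t ∂(gammaMeasure (a + 1) 1)
      = ∫⁻ t, H t ∂(gammaMeasure a 1) := by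
  have h := gammaMeasure_withDensity_pow ha one_pos 1
  simp only [pow_one, rising_succ, rising_zero, Nat.cast_zero, add_zero, one_mul, div_one,
    Nat.cast_one] at h
  rw [← smul_eq_mul, ← lintegral_smul_measure, ← h, lintegral_withDensity_eq_lintegral_mul _
    (by fun_prop) (by fun_prop)]
  refine lintegral_congr_ae ?_
  filter_upwards [ae_pos_gammaMeasure a 1] with t ht
  rw [Pi.mul_apply, ← mul_assoc, ← ENNReal.ofReal_mul ht.le, mul_inv_cancel₀ ht.ne',
    ENNReal.ofReal_one, one_mul]

/-- A point drawn from a Gamma process with probability proportional to its size: the total mass and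
the relative size of the point are independent. -/
lemma lintegral_gammaIntensity_gammaMeasure {θ : ℝ} (hθ : 0 < θ) {G : ℝ × ℝ → ℝ≥0∞}
    (hG : Measurable G) :
    ∫⁻ x, ∫⁻ w, ENNReal.ofReal (x / (x + w)) * G (x + w, x / (x + w)) ∂(gammaMeasure θ 1)
        ∂(gammaIntensity θ)
      = ∫⁻ t, ∫⁻ v, G (t, v) ∂(betaMeasure 1 θ) ∂(gammaMeasure θ 1) := by
  have := isProbabilityMeasure_gammaMeasure hθ one_pos
  have := isProbabilityMeasureBeta one_pos hθ
  have hG' : Measurable fun p : ℝ × ℝ => ENNReal.ofReal p.1⁻¹ * G p := by fun_prop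
  calc _ = ∫⁻ x, ENNReal.ofReal x * ∫⁻ w, ENNReal.ofReal (x + w)⁻¹ * G (x + w, x / (x + w))
        ∂(gammaMeasure θ 1) ∂(gammaIntensity θ) := by
        refine lintegral_congr_ae ?_
        filter_upwards [measure_eq_zero_iff_ae_notMem.1 (gammaIntensity_Iic_zero θ)] with x hx
        simp_rw [div_eq_mul_inv x, ENNReal.ofReal_mul (not_le.1 hx).le, mul_assoc]
        exact lintegral_const_mul _ (by fun_prop)
    _ = ENNReal.ofReal θ * ∫⁻ t, ∫⁻ v, ENNReal.ofReal t⁻¹ * G (t, v) ∂(betaMeasure 1 θ)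
          ∂(gammaMeasure (θ + 1) 1) := by
        rw [lintegral_ofReal_mul_gammaIntensity hθ.le,
          lintegral_gammaMeasure_gammaMeasure one_pos hθ one_pos hG', add_comm]
        exact Measurable.lintegral_prod_right' (f := fun p : ℝ × ℝ =>
          ENNReal.ofReal (p.1 + p.2)⁻¹ * G (p.1 + p.2, p.1 / (p.1 + p.2))) (by fun_prop)
    _ = _ := by
        simp_rw [lintegral_const_mul' _ _ ENNReal.ofReal_ne_top]
        exact lintegral_inv_mul_gammaMeasure hθ hG.lintegral_prod_right'

lemma measurable_prod_stick_mul {k : ℕ} {F : ℝ × (Fin k → ℝ) → ℝ≥0∞} (hF : Measurable F) :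
    Measurable fun p : (Fin k → ℝ) × ℝ =>
      (∏ j, ENNReal.ofReal (stick (p.2 + ∑ l, p.1 l) p.1 j)) *
        F (p.2 + ∑ l, p.1 l, stick (p.2 + ∑ l, p.1 l) p.1) := by
  have : Measurable fun p : (Fin k → ℝ) × ℝ => stick (p.2 + ∑ l, p.1 l) p.1 :=
    measurable_stick.comp (f := fun p : (Fin k → ℝ) × ℝ => (p.2 + ∑ l, p.1 l, p.1)) (by fun_prop)
  fun_prop

lemma prod_stick_mul_cons {k : ℕ} (F : ℝ × (Fin (k + 1) → ℝ) → ℝ≥0∞) (x₀ w : ℝ) (x : Fin k → ℝ) :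
    (∏ j, ENNReal.ofReal (stick (w + ∑ l, (Fin.cons x₀ x : Fin (k + 1) → ℝ) l)
          (Fin.cons x₀ x : Fin (k + 1) → ℝ) j)) *
        F (w + ∑ l, (Fin.cons x₀ x : Fin (k + 1) → ℝ) l,
          stick (w + ∑ l, (Fin.cons x₀ x : Fin (k + 1) → ℝ) l) (Fin.cons x₀ x))
      = (∏ j, ENNReal.ofReal (stick (w + ∑ l, x l) x j)) *
        (ENNReal.ofReal (x₀ / (x₀ + (w + ∑ l, x l))) * F (x₀ + (w + ∑ l, x l),
          Fin.cons (x₀ / (x₀ + (w + ∑ l, x l))) (stick (w + ∑ l, x l) x))) := by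
  rw [Fin.sum_cons, Fin.prod_univ_succ, stick_cons, add_left_comm w x₀]
  simp only [Fin.cons_zero, Fin.cons_succ, add_sub_cancel_left]
  ring

lemma lintegral_rotate {α β γ : Type*} [MeasurableSpace α] [MeasurableSpace β]
    [MeasurableSpace γ] {μ : Measure α} {ν : Measure β} {ρ : Measure γ} [SFinite μ] [SFinite ν]
    [SFinite ρ] {H : α × β × γ → ℝ≥0∞} (hH : Measurable H) :
    ∫⁻ x, ∫⁻ y, ∫⁻ z, H (x, y, z) ∂ρ ∂ν ∂μ = ∫⁻ z, ∫⁻ x, ∫⁻ y, H (x, y, z) ∂ν ∂μ ∂ρ := by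
  have hswap (x : α) := lintegral_lintegral_swap (μ := ν) (ν := ρ) (f := fun y z => H (x, y, z))
    (by exact (hH.comp measurable_prodMk_left).aemeasurable)
  simp_rw [hswap]
  refine lintegral_lintegral_swap (Measurable.aemeasurable ?_)
  exact Measurable.lintegral_prod_right' (f := fun p : (α × γ) × β => H (p.1.1, p.2, p.1.2))
    (by fun_prop)

/-- The points of a Gamma process drawn successively without replacement with probabilities
proportional to their sizes: the total mass and the relative sizes are independent. -/
theorem lintegral_prod_stick_mul {θ : ℝ} (hθ : 0 < θ) (k : ℕ) {F : ℝ × (Fin k → ℝ) → ℝ≥0∞}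
    (hF : Measurable F) :
    ∫⁻ x, ∫⁻ w, (∏ j, ENNReal.ofReal (stick (w + ∑ l, x l) x j)) *
        F (w + ∑ l, x l, stick (w + ∑ l, x l) x) ∂(gammaMeasure θ 1)
        ∂(Measure.pi fun _ : Fin k => gammaIntensity θ)
      = ∫⁻ t, ∫⁻ v, F (t, v) ∂(Measure.pi fun _ => betaMeasure 1 θ) ∂(gammaMeasure θ 1) := by
  have := isProbabilityMeasure_gammaMeasure hθ one_pos
  have := isProbabilityMeasureBeta one_pos hθ
  induction k with
  | zero =>
    simp_rw [lintegral_unique]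
    simp only [Finset.univ_eq_empty, Finset.prod_empty, Finset.sum_empty, one_mul, add_zero,
      measure_univ, Measure.pi_empty_univ, mul_one]
    exact lintegral_congr fun t => by rw [Subsingleton.elim (stick _ _) _]
  | succ k ih =>
    have hH : Measurable fun p : ℝ × ℝ × (Fin k → ℝ) => ENNReal.ofReal (p.1 / (p.1 + p.2.1)) *
        F (p.1 + p.2.1, Fin.cons (p.1 / (p.1 + p.2.1)) p.2.2) := by fun_prop
    calc _ = ∫⁻ x₀, ∫⁻ t, ∫⁻ v, ENNReal.ofReal (x₀ / (x₀ + t)) *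
            F (x₀ + t, Fin.cons (x₀ / (x₀ + t)) v)
          ∂(Measure.pi fun _ => betaMeasure 1 θ) ∂(gammaMeasure θ 1) ∂(gammaIntensity θ) := by
          rw [lintegral_pi_succ _ (measurable_prod_stick_mul hF).lintegral_prod_right']
          refine lintegral_congr fun x₀ => ?_
          simp_rw [prod_stick_mul_cons]
          exact ih (F := fun p => ENNReal.ofReal (x₀ / (x₀ + p.1)) *
            F (x₀ + p.1, Fin.cons (x₀ / (x₀ + p.1)) p.2)) (by fun_prop)
      _ = ∫⁻ v, ∫⁻ x₀, ∫⁻ t, ENNReal.ofReal (x₀ / (x₀ + t)) *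
            F (x₀ + t, Fin.cons (x₀ / (x₀ + t)) v)
          ∂(gammaMeasure θ 1) ∂(gammaIntensity θ) ∂(Measure.pi fun _ => betaMeasure 1 θ) :=
          lintegral_rotate hH
      _ = ∫⁻ v, ∫⁻ t, ∫⁻ v₀, F (t, Fin.cons v₀ v)
          ∂(betaMeasure 1 θ) ∂(gammaMeasure θ 1) ∂(Measure.pi fun _ => betaMeasure 1 θ) :=
          lintegral_congr fun v => lintegral_gammaIntensity_gammaMeasure hθ
            (G := fun p => F (p.1, Fin.cons p.2 v)) (by fun_prop)
      _ = _ := by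
          rw [lintegral_lintegral_swap]
          · refine lintegral_congr fun t => ?_
            rw [lintegral_pi_succ _ (by fun_prop), lintegral_lintegral_swap]
            unfold Function.uncurry
            fun_prop
          · refine Measurable.aemeasurable ?_
            exact Measurable.lintegral_prod_right' (f := fun p : ((Fin k → ℝ) × ℝ) × ℝ =>
              F (p.1.2, Fin.cons p.2 p.1.1)) (by fun_prop)

/-! ### The law of the size-biased rearrangement -/

lemma tsum_compl_toReal_add_sum {ι κ : Type*} [Fintype κ] (i : κ ↪ ι) {y : ι → ℝ}
    (hy : ∀ l, 0 ≤ y l) (hs : Summable y) :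
    (∑' l : ↥(Set.range i)ᶜ, ENNReal.ofReal (y l)).toReal + ∑ j, y (i j) = ∑' l, y l := by
  have hrange : Set.range i = (Finset.univ.map i : Set ι) := by simp
  rw [ENNReal.tsum_toReal_eq fun l => ENNReal.ofReal_ne_top,
    ← hs.sum_add_tsum_compl (s := Finset.univ.map i), Finset.sum_map, add_comm, hrange]
  simp only [ENNReal.toReal_ofReal (hy _)]

lemma sum_embedding_le_tsum {ι κ : Type*} [Fintype κ] (i : κ ↪ ι) {y : ι → ℝ}
    (hy : ∀ l, 0 ≤ y l) (hs : Summable y) : ∑ j, y (i j) ≤ ∑' l, y l := by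
  simpa using hs.sum_le_tsum (Finset.univ.map i) fun l _ => hy l

lemma trim_restrict_eq_trim_withDensity_condProb {Ω : Type*} {m mΩ : MeasurableSpace Ω}
    (hm : m ≤ mΩ) {P : Measure Ω} [IsFiniteMeasure P] {A : Set Ω} (hA : MeasurableSet A) :
    (P.restrict A).trim hm = (P.withDensity fun ω => ENNReal.ofReal ((P⟦A|m⟧) ω)).trim hm := by
  have hnonneg : 0 ≤ᵐ[P] P⟦A|m⟧ :=
    condExp_nonneg (.of_forall fun ω => Set.indicator_nonneg (fun _ _ => zero_le_one) ω)
  have hint : Integrable (A.indicator fun _ => (1 : ℝ)) P := (integrable_const 1).indicator hA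
  refine @Measure.ext _ m _ _ fun B hB => ?_
  rw [trim_measurableSet_eq hm hB, trim_measurableSet_eq hm hB, withDensity_apply _ (hm B hB),
    Measure.restrict_apply (hm B hB), ← ofReal_integral_eq_lintegral_ofReal
    integrable_condExp.integrableOn (ae_restrict_of_ae hnonneg), setIntegral_condExp hm hint hB,
    setIntegral_indicator hA]
  simp

lemma setLIntegral_eq_lintegral_condProb_mul {Ω : Type*} {m mΩ : MeasurableSpace Ω} (hm : m ≤ mΩ)
    {P : Measure Ω} [IsFiniteMeasure P] {A : Set Ω} (hA : MeasurableSet A)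
    {G : Ω → ℝ≥0∞} (hG : Measurable[m] G) :
    ∫⁻ ω in A, G ω ∂P = ∫⁻ ω, ENNReal.ofReal ((P⟦A|m⟧) ω) * G ω ∂P := by
  have hq : Measurable fun ω => ENNReal.ofReal ((P⟦A|m⟧) ω) :=
    (stronglyMeasurable_condExp.mono hm).measurable.ennreal_ofReal
  calc ∫⁻ ω in A, G ω ∂P = ∫⁻ ω, G ω ∂((P.restrict A).trim hm) := (lintegral_trim hm hG).symm
    _ = ∫⁻ ω, G ω ∂(P.withDensity fun ω => ENNReal.ofReal ((P⟦A|m⟧) ω)) := by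
        rw [trim_restrict_eq_trim_withDensity_condProb hm hA, lintegral_trim hm hG]
    _ = _ := lintegral_withDensity_eq_lintegral_mul _ hq (hG.mono hm le_rfl)

lemma iUnion_order {Ω : Type*} (π : ℕ → Ω → ℕ) (k : ℕ) :
    ⋃ i : Fin k ↪ ℕ, {ω | ∀ j : Fin k, π j ω = i j}
      = {ω | Function.Injective fun j : Fin k => π j ω} := by
  ext ω
  simp only [Set.mem_iUnion, Set.mem_ofPred_eq]
  constructor
  · rintro ⟨i, hi⟩
    simpa [hi] using i.injective
  · exact fun h => ⟨⟨_, h⟩, fun j => rfl⟩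

section SizeBiased

variable {Ω : Type*} [MeasurableSpace Ω] {P : Measure Ω} {Y : ℕ → Ω → ℝ} {π : ℕ → Ω → ℕ}

lemma measurable_arrangement (hY : ∀ l, Measurable (Y l)) (hπ : ∀ k, Measurable (π k)) :
    Measurable fun ω k => Y (π k ω) ω :=
  measurable_pi_iff.2 fun k =>
    (measurable_from_prod_countable_right (f := fun p : ℕ × Ω => Y p.1 p.2) hY).comp
      ((hπ k).prodMk measurable_id)

lemma measurable_tsum_stick {κ : Type*} [Preorder κ] [LocallyFiniteOrderBot κ] {x : κ → Ω → ℝ}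
    (hY : ∀ l, Measurable (Y l)) (hx : ∀ j, Measurable (x j)) :
    Measurable fun ω => (∑' l, Y l ω, stick (∑' l, Y l ω) fun j => x j ω) :=
  have hS : Measurable fun ω => ∑' l, Y l ω := Measurable.tsum hY
  hS.prodMk (measurable_stick.comp (hS.prodMk (measurable_pi_lambda _ hx)))

lemma measurableSet_order (hπ : ∀ k, Measurable (π k)) {k : ℕ} (i : Fin k → ℕ) :
    MeasurableSet {ω | ∀ j : Fin k, π j ω = i j} := by
  simp_rw [Set.ofPred_forall]
  exact MeasurableSet.iInter fun j => hπ j (measurableSet_singleton _)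

lemma tsum_setLIntegral_order (hπ : ∀ k, Measurable (π k)) (k : ℕ) (H : Ω → ℝ≥0∞) :
    ∑' i : Fin k ↪ ℕ, ∫⁻ ω in {ω | ∀ j : Fin k, π j ω = i j}, H ω ∂P
      = ∫⁻ ω in {ω | Function.Injective fun j : Fin k => π j ω}, H ω ∂P := by
  have : Countable (Fin k ↪ ℕ) := DFunLike.coe_injective.countable
  rw [← iUnion_order, lintegral_iUnion (s := fun i : Fin k ↪ ℕ =>
    {ω | ∀ j : Fin k, π j ω = i j}) fun i => measurableSet_order hπ i]
  refine fun i i' hii' => Set.disjoint_left.2 fun ω h h' => hii' (DFunLike.ext _ _ fun j => ?_)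
  rw [← h j, ← h' j]

lemma IsSizeBiasedOrder.setLIntegral [IsFiniteMeasure P] (hπ : IsSizeBiasedOrder P Y π)
    (hY : ∀ l, Measurable (Y l)) (hnonneg : ∀ᵐ ω ∂P, ∀ l, 0 ≤ Y l ω)
    (hsum : ∀ᵐ ω ∂P, Summable fun l => Y l ω) {k : ℕ} (i : Fin k ↪ ℕ)
    {F : ℝ × (Fin k → ℝ) → ℝ≥0∞} (hF : Measurable F) :
    ∫⁻ ω in {ω | ∀ j : Fin k, π j ω = i j},
        F (∑' l, Y l ω, stick (∑' l, Y l ω) fun j : Fin k => Y (π j ω) ω) ∂P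
      = ∫⁻ ω, (∏ j, ENNReal.ofReal (stick (∑' l, Y l ω) (fun j => Y (i j) ω) j)) *
        F (∑' l, Y l ω, stick (∑' l, Y l ω) fun j => Y (i j) ω) ∂P := by
  have hA := measurableSet_order hπ.measurable i
  have hG : Measurable[MeasurableSpace.comap (fun ω l => Y l ω) MeasurableSpace.pi] fun ω =>
      F (∑' l, Y l ω, stick (∑' l, Y l ω) fun j => Y (i j) ω) :=
    hF.comp ((measurable_tsum_stick (Y := fun l (y : ℕ → ℝ) => y l)
      (x := fun j (y : ℕ → ℝ) => y (i j)) (by fun_prop) (by fun_prop)).comp (comap_measurable _))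
  calc _ = ∫⁻ ω in {ω | ∀ j : Fin k, π j ω = i j},
        F (∑' l, Y l ω, stick (∑' l, Y l ω) fun j => Y (i j) ω) ∂P :=
        setLIntegral_congr_fun hA fun ω (hω : ∀ j : Fin k, π j ω = i j) => by simp only [hω]
    _ = _ := by
        rw [setLIntegral_eq_lintegral_condProb_mul (measurable_pi_lambda _ hY).comap_le hA hG]
        refine lintegral_congr_ae ?_
        filter_upwards [hπ.condProb k i i.injective, hnonneg, hsum] with ω hcond h0 hs
        rw [hcond, ← ENNReal.ofReal_prod_of_nonneg fun j _ =>
          stick_nonneg (fun j => h0 (i j)) (sum_embedding_le_tsum i h0 hs) j]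
        simp only [stick, Finset.filter_gt_eq_Iio]

variable [IsProbabilityMeasure P] {θ : ℝ}

lemma setLIntegral_injective (hθ : 0 < θ) (hY : IsPoissonProcess P (gammaIntensity θ) Y)
    (hπ : IsSizeBiasedOrder P Y π) {k : ℕ} {F : ℝ × (Fin k → ℝ) → ℝ≥0∞} (hF : Measurable F) :
    ∫⁻ ω in {ω | Function.Injective fun j : Fin k => π j ω},
        F (∑' l, Y l ω, stick (∑' l, Y l ω) fun j : Fin k => Y (π j ω) ω) ∂P
      = ∫⁻ t, ∫⁻ v, F (t, v) ∂(Measure.pi fun _ => betaMeasure 1 θ) ∂(gammaMeasure θ 1) := by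
  have : Countable (Fin k ↪ ℕ) := DFunLike.coe_injective.countable
  have hnonneg : ∀ᵐ ω ∂P, ∀ l, 0 ≤ Y l ω := hY.ae_pos.mono fun ω h l => (h l).le
  have hsum := hY.ae_summable hθ
  calc _ = ∑' i : Fin k ↪ ℕ,
        ∫⁻ ω, (∏ j, ENNReal.ofReal (stick (∑' l, Y l ω) (fun j => Y (i j) ω) j)) *
          F (∑' l, Y l ω, stick (∑' l, Y l ω) fun j => Y (i j) ω) ∂P := by
        rw [← tsum_setLIntegral_order hπ.measurable]
        exact tsum_congr fun i => hπ.setLIntegral hY.measurable hnonneg hsum i hF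
    _ = ∫⁻ ω, ∑' i : Fin k ↪ ℕ,
          (∏ j, ENNReal.ofReal (stick (∑' l, Y l ω) (fun j => Y (i j) ω) j)) *
            F (∑' l, Y l ω, stick (∑' l, Y l ω) fun j => Y (i j) ω) ∂P := by
        refine (MeasureTheory.lintegral_tsum fun i => Measurable.aemeasurable ?_).symm
        have h := measurable_tsum_stick (x := fun j ω => Y (i j) ω) hY.measurable
          fun j => hY.measurable (i j)
        have h1 := measurable_snd.comp h
        exact (Finset.measurable_prod _ fun j _ =>
          ((measurable_pi_apply j).comp h1).ennreal_ofReal).mul (hF.comp h)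
    _ = _ := by
        rw [← lintegral_prod_stick_mul hθ k hF,
          ← hY.lintegral_tsum_gammaIntensity hθ (measurable_prod_stick_mul hF)]
        refine lintegral_congr_ae ?_
        filter_upwards [hnonneg, hsum] with ω h0 hs
        refine tsum_congr fun i => ?_
        simp only [tsum_compl_toReal_add_sum i h0 hs]

lemma ae_injective_fin (hθ : 0 < θ) (hY : IsPoissonProcess P (gammaIntensity θ) Y)
    (hπ : IsSizeBiasedOrder P Y π) (k : ℕ) :
    ∀ᵐ ω ∂P, Function.Injective fun j : Fin k => π j ω := by
  have := isProbabilityMeasure_gammaMeasure hθ one_pos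
  have := isProbabilityMeasureBeta one_pos hθ
  have hmeas : MeasurableSet {ω | Function.Injective fun j : Fin k => π j ω} := by
    have : Countable (Fin k ↪ ℕ) := DFunLike.coe_injective.countable
    rw [← iUnion_order]
    exact MeasurableSet.iUnion fun i => measurableSet_order hπ.measurable i
  have h := setLIntegral_injective hθ hY hπ (k := k) (F := fun _ => 1) measurable_const
  simp only [lintegral_one, measure_univ, Measure.restrict_apply_univ] at h
  exact (mem_ae_iff_prob_eq_one hmeas).2 h

lemma ae_injective (hθ : 0 < θ) (hY : IsPoissonProcess P (gammaIntensity θ) Y)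
    (hπ : IsSizeBiasedOrder P Y π) : ∀ᵐ ω ∂P, Function.Injective fun k => π k ω := by
  filter_upwards [ae_all_iff.2 (ae_injective_fin hθ hY hπ)] with ω hω a b hab
  simpa using @hω (max a b + 1) ⟨a, by omega⟩ ⟨b, by omega⟩ hab

theorem map_tsum_stick (hθ : 0 < θ) (hY : IsPoissonProcess P (gammaIntensity θ) Y)
    (hπ : IsSizeBiasedOrder P Y π) (k : ℕ) :
    P.map (fun ω => (∑' l, Y l ω, fun j : Fin k => stick (∑' l, Y l ω) (fun l => Y (π l ω) ω) j))
      = (gammaMeasure θ 1).prod (Measure.pi fun _ => betaMeasure 1 θ) := by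
  have := isProbabilityMeasure_gammaMeasure hθ one_pos
  have := isProbabilityMeasureBeta one_pos hθ
  simp_rw [← stick_comp_val]
  refine Measure.ext_of_lintegral _ fun F hF => ?_
  rw [lintegral_map hF (measurable_tsum_stick (x := fun (j : Fin k) ω => Y (π j ω) ω) hY.measurable
      fun j => (measurable_pi_apply _).comp (measurable_arrangement hY.measurable hπ.measurable)),
    lintegral_prod _ hF.aemeasurable, ← setLIntegral_injective hθ hY hπ hF,
    Measure.restrict_eq_self_of_ae_mem (s := {ω | Function.Injective fun j : Fin k => π j ω})
      (ae_injective_fin hθ hY hπ k)]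

end SizeBiased

lemma ae_tendsto_zero_of_summable_integral {Ω : Type*} [MeasurableSpace Ω] {μ : Measure Ω}
    {f : ℕ → Ω → ℝ} (hint : ∀ k, Integrable (f k) μ) (hnonneg : ∀ k, 0 ≤ᵐ[μ] f k)
    (hsum : Summable fun k => ∫ ω, f k ω ∂μ) : ∀ᵐ ω ∂μ, Tendsto (fun k => f k ω) atTop (𝓝 0) := by
  have hmeas (k : ℕ) : AEMeasurable (fun ω => ENNReal.ofReal (f k ω)) μ :=
    (hint k).aemeasurable.ennreal_ofReal
  have hfin : ∫⁻ ω, ∑' k, ENNReal.ofReal (f k ω) ∂μ ≠ ∞ := by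
    rw [lintegral_tsum hmeas]
    simp_rw [← fun k => ofReal_integral_eq_lintegral_ofReal (hint k) (hnonneg k)]
    rw [← ENNReal.ofReal_tsum_of_nonneg (fun k => integral_nonneg_of_ae (hnonneg k)) hsum]
    exact ENNReal.ofReal_ne_top
  filter_upwards [ae_lt_top' (AEMeasurable.tsum hmeas) hfin, ae_all_iff.2 hnonneg]
    with ω hω h0
  refine ((ENNReal.tendsto_toReal ENNReal.zero_ne_top).comp
    (ENNReal.tendsto_atTop_zero_of_tsum_ne_top hω.ne)).congr fun k => ?_
  exact ENNReal.toReal_ofReal (h0 k)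

section SizeBiased

variable {Ω : Type*} [MeasurableSpace Ω] {P : Measure Ω} [IsProbabilityMeasure P]
  {Y : ℕ → Ω → ℝ} {π : ℕ → Ω → ℕ} {θ : ℝ}

lemma integrable_and_integral_eval_tsum_mul_prod_eval_stick (hθ : 0 < θ)
    (hY : IsPoissonProcess P (gammaIntensity θ) Y) (hπ : IsSizeBiasedOrder P Y π)
    (p : ℝ[X]) (q : ℕ → ℝ[X]) (K : ℕ) :
    Integrable (fun ω => p.eval (∑' l, Y l ω) * ∏ j ∈ Finset.range K,
        (q j).eval (stick (∑' l, Y l ω) (fun l => Y (π l ω) ω) j)) P ∧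
      ∫ ω, p.eval (∑' l, Y l ω) * ∏ j ∈ Finset.range K,
          (q j).eval (stick (∑' l, Y l ω) (fun l => Y (π l ω) ω) j) ∂P
        = (∫ x, p.eval x ∂(gammaMeasure θ 1)) *
          ∏ j ∈ Finset.range K, ∫ v, (q j).eval v ∂(betaMeasure 1 θ) := by
  have := isProbabilityMeasure_gammaMeasure hθ one_pos
  have := isProbabilityMeasureBeta one_pos hθ
  let Φ (ω : Ω) : ℝ × (Fin K → ℝ) :=
    (∑' l, Y l ω, fun j => stick (∑' l, Y l ω) (fun l => Y (π l ω) ω) j)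
  have hΦ : Measurable Φ := by
    have h := measurable_tsum_stick (x := fun j ω => Y (π j ω) ω) hY.measurable fun j =>
      (measurable_pi_apply j).comp (measurable_arrangement hY.measurable hπ.measurable)
    exact h.fst.prodMk (measurable_pi_lambda _ fun j => (measurable_pi_apply _).comp h.snd)
  let Q (z : ℝ × (Fin K → ℝ)) : ℝ := p.eval z.1 * ∏ j : Fin K, (q j).eval (z.2 j)
  have hQ : Integrable Q (P.map Φ) := by
    rw [map_tsum_stick hθ hY hπ]
    exact (integrable_eval_gammaMeasure hθ one_pos p).mul_prod
      (Integrable.fintype_prod (f := fun (j : Fin K) v => (q j).eval v) fun j =>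
        integrable_betaMeasure_of_continuous one_pos hθ (q j).continuous)
  have hQΦ (ω : Ω) : p.eval (∑' l, Y l ω) * ∏ j ∈ Finset.range K,
      (q j).eval (stick (∑' l, Y l ω) (fun l => Y (π l ω) ω) j) = Q (Φ ω) := by
    rw [← Fin.prod_univ_eq_prod_range fun j =>
      (q j).eval (stick (∑' l, Y l ω) (fun l => Y (π l ω) ω) j)]
  simp_rw [hQΦ]
  refine ⟨hQ.comp_measurable hΦ, ?_⟩
  calc ∫ ω, Q (Φ ω) ∂P = ∫ z, Q z ∂(P.map Φ) :=
        (integral_map hΦ.aemeasurable hQ.aestronglyMeasurable).symm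
    _ = _ := by
        rw [map_tsum_stick hθ hY hπ]
        exact (integral_prod_mul (fun x => p.eval x)
          (fun v : Fin K → ℝ => ∏ j : Fin K, (q j).eval (v j))).trans
          (by rw [integral_fintype_prod_eq_prod (fun (j : Fin K) v => (q j).eval v),
            Fin.prod_univ_eq_prod_range fun j => ∫ v, (q j).eval v ∂(betaMeasure 1 θ)])

lemma ae_remainder_pos (hθ : 0 < θ) (hY : IsPoissonProcess P (gammaIntensity θ) Y)
    (hπ : IsSizeBiasedOrder P Y π) :
    ∀ᵐ ω ∂P, ∀ k, 0 < ∑' l, Y l ω - ∑ i ∈ Finset.range k, Y (π i ω) ω := by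
  filter_upwards [hY.ae_pos, hY.ae_summable hθ, ae_injective hθ hY hπ] with ω hpos hsum hinj k
  have h := hsum.sum_le_tsum ((Finset.range (k + 1)).map ⟨fun j => π j ω, hinj⟩)
    fun l _ => (hpos l).le
  rw [Finset.sum_map, Finset.sum_range_succ] at h
  exact sub_pos.2 ((lt_add_of_pos_right _ (hpos (π k ω))).trans_le h)

lemma integrable_and_integral_prod_one_sub_stick (hθ : 0 < θ)
    (hY : IsPoissonProcess P (gammaIntensity θ) Y) (hπ : IsSizeBiasedOrder P Y π) (k : ℕ) :
    Integrable (fun ω =>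
        ∏ j ∈ Finset.range k, (1 - stick (∑' l, Y l ω) (fun l => Y (π l ω) ω) j)) P ∧
      ∫ ω, ∏ j ∈ Finset.range k, (1 - stick (∑' l, Y l ω) (fun l => Y (π l ω) ω) j) ∂P
        = (θ / (1 + θ)) ^ k := by
  have := isProbabilityMeasure_gammaMeasure hθ one_pos
  have := isProbabilityMeasureBeta one_pos (add_pos hθ one_pos)
  have hmean : ∫ v, (1 - v) ∂(betaMeasure 1 θ) = θ / (1 + θ) := by
    simpa [rising_succ] using
      integral_one_sub_pow_mul_betaMeasure one_pos hθ 1 fun _ => 1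
  have h := integrable_and_integral_eval_tsum_mul_prod_eval_stick hθ hY hπ 1 (fun _ => 1 - X) k
  simpa only [eval_one, eval_sub, eval_X, integral_const, probReal_univ, one_smul, one_mul,
    Finset.prod_const, Finset.card_range, hmean] using h

/-- The expected fraction of the total mass that is left after `k` draws decays geometrically. -/
lemma ae_hasSum_arrangement (hθ : 0 < θ) (hY : IsPoissonProcess P (gammaIntensity θ) Y)
    (hπ : IsSizeBiasedOrder P Y π) :
    ∀ᵐ ω ∂P, HasSum (fun k => Y (π k ω) ω) (∑' l, Y l ω) := by
  have hprod := ae_remainder_pos hθ hY hπ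
  have hlim := ae_tendsto_zero_of_summable_integral
    (fun k => (integrable_and_integral_prod_one_sub_stick hθ hY hπ k).1)
    (fun k => by
      filter_upwards [hprod] with ω hrem
      refine (div_nonneg (hrem k).le ?_).trans_eq (prod_one_sub_stick hrem k).symm
      simpa using (hrem 0).le)
    (by
      simp_rw [fun k => (integrable_and_integral_prod_one_sub_stick hθ hY hπ k).2]
      exact summable_geometric_of_lt_one (by positivity) ((div_lt_one (by positivity)).2 (by simp)))
  filter_upwards [hlim, hprod, hY.ae_pos] with ω hω hrem hpos
  have hs : 0 < ∑' l, Y l ω := by simpa using hrem 0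
  simp_rw [prod_one_sub_stick hrem] at hω
  rw [hasSum_iff_tendsto_nat_of_nonneg fun k => (hpos _).le]
  have h := (hω.mul_const (∑' l, Y l ω)).const_sub (∑' l, Y l ω)
  simpa only [div_mul_cancel₀ _ hs.ne', sub_sub_cancel, zero_mul, sub_zero] using h

end SizeBiased

/-! ### Orthogonality of the Laguerre and Jacobi polynomials -/

lemma rising_eq_prod (a : ℝ) (k : ℕ) : rising a k = ∏ i ∈ Finset.range k, (a + i) := by
  induction k with
  | zero => simp
  | succ k ih => rw [rising_succ, ih, Finset.prod_range_succ]

lemma rising_add (a : ℝ) (n m : ℕ) : rising a (n + m) = rising a n * rising (a + n) m := by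
  simp_rw [rising_eq_prod, Finset.prod_range_add, Nat.cast_add, add_assoc]

lemma rising_neg_div_factorial (m k : ℕ) :
    rising (-(m : ℝ)) k / k.factorial = (-1) ^ k * m.choose k := by
  rw [rising, ascPochhammer_eval_neg_eq_descPochhammer, descPochhammer_eval_eq_descFactorial,
    Nat.descFactorial_eq_factorial_mul_choose, Nat.cast_mul]
  field_simp

/-- The polynomial `p` with `p(x) = (x + a)_k`. -/
def risingShift (a : ℝ) (k : ℕ) : ℝ[X] := (ascPochhammer ℝ k).comp (X + C a)

lemma eval_risingShift (a : ℝ) (k : ℕ) (x : ℝ) : (risingShift a k).eval x = rising (a + x) k := by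
  simp [risingShift, rising, add_comm]

lemma natDegree_risingShift (a : ℝ) (k : ℕ) : (risingShift a k).natDegree = k := by
  rw [risingShift, natDegree_comp, ascPochhammer_natDegree, natDegree_X_add_C, mul_one]

lemma sum_choose_mul_eval_eq_zero {p : ℝ[X]} {n : ℕ} (hp : p.natDegree < n) :
    ∑ k ∈ Finset.range (n + 1), (-1) ^ k * (n.choose k : ℝ) * p.eval (k : ℝ) = 0 := by
  have hdiff := congrFun (Polynomial.fwdDiff_iter_eq_zero_of_degree_lt hp) 0
  rw [fwdDiff_iter_eq_sum_shift] at hdiff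
  calc ∑ k ∈ Finset.range (n + 1), (-1) ^ k * (n.choose k : ℝ) * p.eval (k : ℝ)
      = (-1) ^ n * ∑ k ∈ Finset.range (n + 1),
          ((-1 : ℤ) ^ (n - k) * n.choose k) • p.eval (0 + k • 1 : ℝ) := by
        rw [Finset.mul_sum]
        refine Finset.sum_congr rfl fun k hk => ?_
        have hsign : (-1 : ℝ) ^ k = (-1) ^ n * (-1) ^ (n - k) := by
          rw [← pow_add]
          exact neg_one_pow_congr (by grind)
        simp only [zsmul_eq_mul, nsmul_eq_mul, mul_one, zero_add]
        push_cast
        rw [hsign]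
        ring
    _ = 0 := by rw [hdiff, Pi.zero_apply, mul_zero]

lemma integral_mul_sum_pow_eq_zero {E : Type*} [MeasurableSpace E] {μ : Measure E} {f g : E → ℝ}
    {n k : ℕ} (hk : k ≤ n) (hint : ∀ j, Integrable (fun x => f x * g x ^ j) μ)
    (horth : ∀ j < n, ∫ x, f x * g x ^ j ∂μ = 0) (c : ℕ → ℝ) :
    ∫ x, f x * ∑ j ∈ Finset.range k, c j * g x ^ j ∂μ = 0 := by
  simp_rw [Finset.mul_sum, mul_left_comm (f _) (c _)]
  rw [integral_finsetSum _ fun j _ => (hint j).const_mul _]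
  refine Finset.sum_eq_zero fun j hj => ?_
  rw [integral_const_mul, horth j ((Finset.mem_range.1 hj).trans_le hk), mul_zero]

lemma integral_eval_mul_self_pos {μ : Measure ℝ} [NullSingletonClass μ] [NeZero μ] {p : ℝ[X]}
    (hp : p ≠ 0) (hint : Integrable (fun x => p.eval x * p.eval x) μ) :
    0 < ∫ x, p.eval x * p.eval x ∂μ := by
  rw [integral_pos_iff_support_of_nonneg (fun x => mul_self_nonneg _) hint, pos_iff_ne_zero]
  intro hsupp
  have hroots : μ {x | p.IsRoot x} = 0 := (finite_setOfPred_isRoot hp).measure_zero μ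
  refine NeZero.ne μ (Measure.measure_univ_eq_zero.1 (measure_mono_null (fun x _ => ?_)
    (measure_union_null hsupp hroots)))
  by_cases hx : p.eval x = 0
  · exact Or.inr hx
  · exact Or.inl (by simpa using hx)

/-- The coefficient of `x ^ k` in the Laguerre polynomial `L_m^a(x)`. -/
def laguerreCoeff (a : ℝ) (m k : ℕ) : ℝ :=
  rising a m / m.factorial * (rising (-(m : ℝ)) k / (rising a k * k.factorial))

lemma laguerre_eq_sum (a : ℝ) (m : ℕ) :
    laguerre a m = ∑ k ∈ Finset.range (m + 1), C (laguerreCoeff a m k) * X ^ k := by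
  simp_rw [laguerre, Finset.mul_sum, laguerreCoeff, C_mul, mul_assoc]

lemma eval_laguerre (a : ℝ) (m : ℕ) (x : ℝ) :
    (laguerre a m).eval x = ∑ k ∈ Finset.range (m + 1), laguerreCoeff a m k * x ^ k := by
  simp [laguerre_eq_sum, eval_finsetSum]

lemma coeff_laguerre_self_ne_zero {a : ℝ} (ha : 0 < a) (m : ℕ) : (laguerre a m).coeff m ≠ 0 := by
  have hlead : rising (-(m : ℝ)) m = (-1) ^ m * m.factorial := by
    have h := rising_neg_div_factorial m m
    rwa [Nat.choose_self, Nat.cast_one, mul_one, div_eq_iff (by positivity)] at h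
  have hrising := rising_pos ha m
  rw [laguerre_eq_sum, finsetSum_coeff]
  simp only [coeff_C_mul, coeff_X_pow, mul_ite, mul_one, mul_zero, Finset.sum_ite_eq,
    Finset.mem_range, Nat.lt_succ_self, if_true, laguerreCoeff, hlead]
  positivity

lemma laguerre_ne_zero {a : ℝ} (ha : 0 < a) (m : ℕ) : laguerre a m ≠ 0 := fun h =>
  coeff_laguerre_self_ne_zero ha m (by rw [h, coeff_zero])

lemma natDegree_laguerre {a : ℝ} (ha : 0 < a) (m : ℕ) : (laguerre a m).natDegree = m := by
  refine natDegree_eq_of_le_of_coeff_ne_zero ?_ (coeff_laguerre_self_ne_zero ha m)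
  rw [laguerre_eq_sum]
  exact natDegree_sum_le_of_forall_le _ _ fun k hk =>
    (natDegree_C_mul_X_pow_le _ _).trans (Finset.mem_range_succ_iff.1 hk)

lemma integral_pow_gammaMeasure {a : ℝ} (ha : 0 < a) (s : ℕ) :
    ∫ x, x ^ s ∂(gammaMeasure a 1) = rising a s := by
  have := isProbabilityMeasure_gammaMeasure (a := a + s) (by positivity) one_pos
  simpa using integral_pow_mul_gammaMeasure ha one_pos s fun _ => 1

lemma integral_laguerre_mul_pow {a : ℝ} (ha : 0 < a) {m j : ℕ} (hj : j < m) :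
    ∫ x, (laguerre a m).eval x * x ^ j ∂(gammaMeasure a 1) = 0 := by
  simp_rw [eval_laguerre, Finset.sum_mul, mul_assoc, ← pow_add]
  rw [integral_finsetSum _ fun k _ => (integrable_pow_gammaMeasure ha one_pos _).const_mul _]
  simp_rw [integral_const_mul, integral_pow_gammaMeasure ha]
  rw [← mul_zero (rising a m / m.factorial),
    ← sum_choose_mul_eval_eq_zero ((natDegree_risingShift a j).trans_lt hj), Finset.mul_sum]
  refine Finset.sum_congr rfl fun k _ => ?_
  have hk := rising_pos ha k
  rw [eval_risingShift, rising_add, ← rising_neg_div_factorial, laguerreCoeff]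
  field_simp

lemma integral_laguerre_mul_laguerre {a : ℝ} (ha : 0 < a) {m m' : ℕ} (h : m ≠ m') :
    ∫ x, (laguerre a m).eval x * (laguerre a m').eval x ∂(gammaMeasure a 1) = 0 := by
  wlog hlt : m' < m generalizing m m'
  · simp_rw [mul_comm (eval _ (laguerre a m))]
    exact this h.symm (h.lt_of_le (not_lt.1 hlt))
  simp_rw [eval_laguerre a m']
  refine integral_mul_sum_pow_eq_zero hlt (fun j => ?_)
    (fun j hj => integral_laguerre_mul_pow ha hj) _
  have hint := integrable_eval_gammaMeasure ha one_pos (laguerre a m * X ^ j)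
  simpa only [eval_mul, eval_pow, eval_X] using hint

/-- The coefficient of `(1 - x) ^ k` in the shifted Jacobi polynomial `R_n^{(α, β)}(x)`. -/
def jacobiCoeff (α β : ℝ) (n k : ℕ) : ℝ :=
  rising (-(n : ℝ)) k * rising (n + (α + β - 1)) k / (rising β k * k.factorial)

lemma eval_jacobi (a b : ℝ) (n : ℕ) (x : ℝ) :
    (jacobi a b n).eval x = rising (a + 1) n / n.factorial *
      ∑ k ∈ Finset.range (n + 1), jacobiCoeff (b + 1) (a + 1) n k * ((1 - x) / 2) ^ k := by
  rw [jacobi, eval_mul, eval_C, eval_finsetSum]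
  congr 1
  refine Finset.sum_congr rfl fun k _ => ?_
  simp only [eval_mul, eval_C, eval_pow, eval_sub, eval_one, eval_X, jacobiCoeff]
  ring_nf

lemma eval_one_jacobi (a b : ℝ) (n : ℕ) :
    (jacobi a b n).eval 1 = rising (a + 1) n / n.factorial := by
  rw [eval_jacobi, Finset.sum_range_succ']
  simp [jacobiCoeff]

lemma eval_shiftedJacobi (α : ℝ) {β : ℝ} (hβ : 0 < β) (n : ℕ) (x : ℝ) :
    (shiftedJacobi α β n).eval x
      = ∑ k ∈ Finset.range (n + 1), jacobiCoeff α β n k * (1 - x) ^ k := by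
  have hne : rising β n / n.factorial ≠ 0 := (div_pos (rising_pos hβ n) (by positivity)).ne'
  have harg : (1 - (2 * X - 1 : ℝ[X]).eval x) / 2 = 1 - x := by
    simp only [eval_sub, eval_mul, eval_ofNat, eval_X, eval_one]
    ring
  rw [shiftedJacobi, eval_mul, eval_C, eval_one_jacobi, eval_comp, eval_jacobi, sub_add_cancel,
    sub_add_cancel, inv_mul_cancel_left₀ hne, harg]

lemma eval_one_shiftedJacobi (α : ℝ) {β : ℝ} (hβ : 0 < β) (n : ℕ) :
    (shiftedJacobi α β n).eval 1 = 1 := by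
  rw [eval_shiftedJacobi α hβ, Finset.sum_range_succ']
  simp [jacobiCoeff]

lemma eval_shiftedJacobi_zero (α : ℝ) {β : ℝ} (hβ : 0 < β) (x : ℝ) :
    (shiftedJacobi α β 0).eval x = 1 := by
  simp [eval_shiftedJacobi α hβ, jacobiCoeff]

lemma integral_one_sub_pow_betaMeasure {α β : ℝ} (hα : 0 < α) (hβ : 0 < β) (s : ℕ) :
    ∫ v, (1 - v) ^ s ∂(betaMeasure α β) = rising β s / rising (α + β) s := by
  have := isProbabilityMeasureBeta hα (β := β + s) (by positivity)
  simpa using integral_one_sub_pow_mul_betaMeasure hα hβ s fun _ => 1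

/-- With `n = j + d + 1`, the summands of the orthogonality sum are `(-1) ^ k * n.choose k` times a
polynomial in `k` of degree `j + d < n`. -/
lemma jacobiCoeff_mul_moment {α β : ℝ} (hα : 0 < α) (hβ : 0 < β) (j d k : ℕ) :
    jacobiCoeff α β (j + d + 1) k * (rising β (k + j) / rising (α + β) (k + j))
      = (rising (α + β) (j + d))⁻¹ * ((-1) ^ k * (j + d + 1).choose k *
        (risingShift β j * risingShift (α + β + j) d).eval (k : ℝ)) := by
  have hsplit : rising (α + β) (k + j) * rising (α + β + j + k) d
      = rising (α + β) (j + d) * rising (((j + d + 1 : ℕ) : ℝ) + (α + β - 1)) k := by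
    rw [show α + β + j + k = α + β + (k + j : ℕ) by push_cast; ring,
      show ((j + d + 1 : ℕ) : ℝ) + (α + β - 1) = α + β + (j + d : ℕ) by push_cast; ring,
      ← rising_add, ← rising_add, show k + j + d = j + d + k by ring]
  have hβk := rising_pos hβ k
  have hkj := rising_pos (add_pos hα hβ) (k + j)
  have hjd := rising_pos (add_pos hα hβ) (j + d)
  rw [jacobiCoeff, eval_mul, eval_risingShift, eval_risingShift, ← rising_neg_div_factorial,
    rising_add β]
  field_simp
  linear_combination
    -rising (-((j + d + 1 : ℕ) : ℝ)) k * rising (β + k) j * hsplit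

lemma integral_shiftedJacobi_mul_pow {α β : ℝ} (hα : 0 < α) (hβ : 0 < β) {n j : ℕ} (hj : j < n) :
    ∫ v, (shiftedJacobi α β n).eval v * (1 - v) ^ j ∂(betaMeasure α β) = 0 := by
  obtain ⟨d, rfl⟩ := Nat.exists_eq_add_of_lt hj
  have hdeg : (risingShift β j * risingShift (α + β + j) d).natDegree < j + d + 1 :=
    natDegree_mul_le.trans_lt (by simp only [natDegree_risingShift, Nat.lt_succ_self])
  simp_rw [eval_shiftedJacobi α hβ, Finset.sum_mul, mul_assoc, ← pow_add]
  rw [integral_finsetSum _ fun k _ =>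
    (integrable_betaMeasure_of_continuous hα hβ (by fun_prop)).const_mul _]
  simp_rw [integral_const_mul, integral_one_sub_pow_betaMeasure hα hβ,
    jacobiCoeff_mul_moment hα hβ]
  rw [← Finset.mul_sum, sum_choose_mul_eval_eq_zero hdeg, mul_zero]

lemma integral_shiftedJacobi_mul_shiftedJacobi {α β : ℝ} (hα : 0 < α) (hβ : 0 < β) {n n' : ℕ}
    (h : n ≠ n') :
    ∫ v, (shiftedJacobi α β n).eval v * (shiftedJacobi α β n').eval v ∂(betaMeasure α β) = 0 := by
  wlog hlt : n' < n generalizing n n'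
  · simp_rw [mul_comm (eval _ (shiftedJacobi α β n))]
    exact this h.symm (h.lt_of_le (not_lt.1 hlt))
  simp_rw [eval_shiftedJacobi α hβ n']
  exact integral_mul_sum_pow_eq_zero hlt
    (fun j => integrable_betaMeasure_of_continuous hα hβ (by fun_prop))
    (fun j hj => integral_shiftedJacobi_mul_pow hα hβ hj) _

/-! ### The multiple Laguerre polynomials in terms of the sticks -/

/-- The factor of the multiple Laguerre polynomial that depends on the sum of the sequence. -/
def radialPoly (θ : ℝ) (m : ℕ) (n : ℕ →₀ ℕ) : ℝ[X] :=
  laguerre (θ + 2 * n.degree) m * X ^ n.degree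

/-- The factor of the multiple Laguerre polynomial that depends on the `j`-th stick. -/
def stickPoly (θ : ℝ) (n : ℕ →₀ ℕ) (j : ℕ) : ℝ[X] :=
  shiftedJacobi 1 (θ + 2 * tailDegree n j) (n j) * (1 - X) ^ tailDegree n j

lemma radialPoly_ne_zero {θ : ℝ} (hθ : 0 < θ) (m : ℕ) (n : ℕ →₀ ℕ) : radialPoly θ m n ≠ 0 :=
  mul_ne_zero (laguerre_ne_zero (by positivity) m) (pow_ne_zero _ X_ne_zero)

lemma stickPoly_ne_zero {θ : ℝ} (hθ : 0 < θ) (n : ℕ →₀ ℕ) (j : ℕ) : stickPoly θ n j ≠ 0 := by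
  refine mul_ne_zero (fun h => ?_) (pow_ne_zero _ fun h => ?_)
  · have h1 := eval_one_shiftedJacobi 1 (β := θ + 2 * tailDegree n j) (by positivity) (n j)
    simp [h] at h1
  · simpa using congrArg (eval 0) h

lemma integral_radialPoly_mul {θ : ℝ} (hθ : 0 < θ) (n : ℕ →₀ ℕ) {m m' : ℕ} (h : m ≠ m') :
    ∫ x, (radialPoly θ m n).eval x * (radialPoly θ m' n).eval x ∂(gammaMeasure θ 1) = 0 := by
  have hshift : θ + (2 * n.degree : ℕ) = θ + 2 * n.degree := by push_cast; rfl
  calc ∫ x, (radialPoly θ m n).eval x * (radialPoly θ m' n).eval x ∂(gammaMeasure θ 1)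
      = ∫ x, x ^ (2 * n.degree) * ((laguerre (θ + 2 * n.degree) m).eval x *
          (laguerre (θ + 2 * n.degree) m').eval x) ∂(gammaMeasure θ 1) := by
        congr with x
        simp only [radialPoly, eval_mul, eval_pow, eval_X]
        ring
    _ = 0 := by
        rw [integral_pow_mul_gammaMeasure hθ one_pos, hshift,
          integral_laguerre_mul_laguerre (by positivity) h, mul_zero]

lemma integral_stickPoly_mul {θ : ℝ} (hθ : 0 < θ) {n n' : ℕ →₀ ℕ} {j : ℕ} (h : n j ≠ n' j)
    (htail : ∀ i, j < i → n i = n' i) :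
    ∫ v, (stickPoly θ n j).eval v * (stickPoly θ n' j).eval v ∂(betaMeasure 1 θ) = 0 := by
  have hN : tailDegree n j = tailDegree n' j := by
    refine Finset.sum_congr (Finset.ext fun i => ?_) fun i hi => htail i (Finset.mem_filter.1 hi).2
    simp only [Finset.mem_filter, Finsupp.mem_support_iff]
    exact and_congr_left fun hi => by rw [htail i hi]
  set N := tailDegree n' j
  have hshift : θ + (2 * N : ℕ) = θ + 2 * N := by push_cast; rfl
  calc ∫ v, (stickPoly θ n j).eval v * (stickPoly θ n' j).eval v ∂(betaMeasure 1 θ)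
      = ∫ v, (1 - v) ^ (2 * N) * ((shiftedJacobi 1 (θ + 2 * N) (n j)).eval v *
          (shiftedJacobi 1 (θ + 2 * N) (n' j)).eval v) ∂(betaMeasure 1 θ) := by
        congr with v
        simp only [stickPoly, hN, eval_mul, eval_pow, eval_sub, eval_one, eval_X]
        ring
    _ = 0 := by
        rw [integral_one_sub_pow_mul_betaMeasure one_pos hθ, hshift,
          integral_shiftedJacobi_mul_shiftedJacobi one_pos (by positivity) h, mul_zero]

lemma one_sub_sum_div {s : ℝ} (hs : s ≠ 0) (t : Finset ℕ) (y : ℕ → ℝ) :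
    1 - ∑ i ∈ t, y i / s = (s - ∑ i ∈ t, y i) / s := by
  rw [← Finset.sum_div, sub_div, div_self hs]

lemma gemPoly_div {s : ℝ} (hs : s ≠ 0) (θ : ℝ) (n : ℕ →₀ ℕ) (y : ℕ → ℝ) :
    gemPoly θ n (fun j => y j / s) = ∏ j ∈ n.support,
      (shiftedJacobi 1 (θ + 2 * tailDegree n j) (n j)).eval (stick s y j) *
        ((s - ∑ i ∈ Finset.range j, y i) / s) ^ n j := by
  simp_rw [gemPoly, one_sub_sum_div hs, div_div_div_cancel_right₀ hs, stick, Nat.Iio_eq_range]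

lemma prod_support_prod_range_pow {n : ℕ →₀ ℕ} {K : ℕ} (hK : n.support ⊆ Finset.range K)
    (w : ℕ → ℝ) :
    ∏ j ∈ n.support, (∏ i ∈ Finset.range j, w i) ^ n j
      = ∏ i ∈ Finset.range K, w i ^ tailDegree n i := by
  simp_rw [← Finset.prod_pow, tailDegree, ← Finset.prod_pow_eq_pow_sum]
  refine Finset.prod_comm' fun j i => ?_
  simp only [Finset.mem_filter, Finset.mem_range]
  exact ⟨fun h => ⟨h, h.2.trans (Finset.mem_range.1 (hK h.1))⟩, fun h => h.1⟩

lemma multipleLaguerre_eq_prod {θ : ℝ} (hθ : 0 < θ) (m : ℕ) {n : ℕ →₀ ℕ} {K : ℕ}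
    (hK : n.support ⊆ Finset.range K) {y : ℕ → ℝ} {s : ℝ} (hs : HasSum y s)
    (hrem : ∀ k, 0 < s - ∑ i ∈ Finset.range k, y i) :
    multipleLaguerre θ m n y = (radialPoly θ m n).eval s *
      ∏ j ∈ Finset.range K, (stickPoly θ n j).eval (stick s y j) := by
  have hs0 : s ≠ 0 := by simpa using (hrem 0).ne'
  rw [multipleLaguerre, hs.tsum_eq, radialPoly, eval_mul, eval_pow, eval_X, gemPoly_div hs0]
  simp only [← prod_one_sub_stick hrem, stickPoly, eval_mul, eval_pow, eval_sub, eval_one, eval_X,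
    Finset.prod_mul_distrib, prod_support_prod_range_pow hK]
  congr 2
  refine Finset.prod_subset hK fun j _ hj => ?_
  rw [Finsupp.notMem_support_iff.1 hj, eval_shiftedJacobi_zero 1 (by positivity)]

lemma measurable_multipleLaguerre (θ : ℝ) (m : ℕ) (n : ℕ →₀ ℕ) :
    Measurable (multipleLaguerre θ m n) := by
  have heval (p : ℝ[X]) {g : (ℕ → ℝ) → ℝ} (hg : Measurable g) : Measurable fun y => p.eval (g y) :=
    p.continuous.measurable.comp hg
  have hsum : Measurable fun y : ℕ → ℝ => ∑' i, y i := .tsum measurable_pi_apply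
  refine ((heval _ hsum).mul (hsum.pow_const _)).mul ?_
  exact Finset.measurable_prod _ fun j _ => (heval _ (by fun_prop)).mul (by fun_prop)

/-! ### Orthogonality of the multiple Laguerre polynomials -/

section SizeBiased

variable {Ω : Type*} [MeasurableSpace Ω] {P : Measure Ω} [IsProbabilityMeasure P]
  {Y : ℕ → Ω → ℝ} {π : ℕ → Ω → ℕ} {θ : ℝ}

lemma integrable_and_integral_multipleLaguerre_mul (hθ : 0 < θ)
    (hY : IsPoissonProcess P (gammaIntensity θ) Y) (hπ : IsSizeBiasedOrder P Y π) (m m' : ℕ)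
    {n n' : ℕ →₀ ℕ} {K : ℕ} (hK : n.support ⊆ Finset.range K)
    (hK' : n'.support ⊆ Finset.range K) :
    Integrable (fun y => multipleLaguerre θ m n y * multipleLaguerre θ m' n' y)
      (P.map fun ω k => Y (π k ω) ω) ∧
    ∫ y, multipleLaguerre θ m n y * multipleLaguerre θ m' n' y ∂(P.map fun ω k => Y (π k ω) ω)
      = (∫ x, (radialPoly θ m n).eval x * (radialPoly θ m' n').eval x ∂(gammaMeasure θ 1)) *
        ∏ j ∈ Finset.range K,
          ∫ v, (stickPoly θ n j).eval v * (stickPoly θ n' j).eval v ∂(betaMeasure 1 θ) := by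
  have hmeas : Measurable fun y => multipleLaguerre θ m n y * multipleLaguerre θ m' n' y :=
    (measurable_multipleLaguerre θ m n).mul (measurable_multipleLaguerre θ m' n')
  have harr := measurable_arrangement hY.measurable hπ.measurable
  have heq : (fun ω => multipleLaguerre θ m n (fun k => Y (π k ω) ω) *
      multipleLaguerre θ m' n' (fun k => Y (π k ω) ω)) =ᵐ[P] fun ω =>
        (radialPoly θ m n * radialPoly θ m' n').eval (∑' l, Y l ω) * ∏ j ∈ Finset.range K,
          (stickPoly θ n j * stickPoly θ n' j).eval
            (stick (∑' l, Y l ω) (fun l => Y (π l ω) ω) j) := by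
    filter_upwards [ae_hasSum_arrangement hθ hY hπ, ae_remainder_pos hθ hY hπ] with ω hsum hrem
    simp only [multipleLaguerre_eq_prod hθ _ hK hsum hrem,
      multipleLaguerre_eq_prod hθ _ hK' hsum hrem, eval_mul, Finset.prod_mul_distrib]
    ring
  have hprod := integrable_and_integral_eval_tsum_mul_prod_eval_stick hθ hY hπ
    (radialPoly θ m n * radialPoly θ m' n') (fun j => stickPoly θ n j * stickPoly θ n' j) K
  rw [integrable_map_measure hmeas.aestronglyMeasurable harr.aemeasurable,
    integral_map harr.aemeasurable hmeas.aestronglyMeasurable, integral_congr_ae heq, hprod.2]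
  refine ⟨hprod.1.congr heq.symm, ?_⟩
  simp only [eval_mul]

lemma exists_ne_and_forall_lt_eq {n n' : ℕ →₀ ℕ} (h : n ≠ n') :
    ∃ j, n j ≠ n' j ∧ ∀ i, j < i → n i = n' i := by
  obtain ⟨j, hj, hmax⟩ := Finset.exists_max_image (n.neLocus n') id
    (Finsupp.nonempty_neLocus_iff.2 h)
  exact ⟨j, Finsupp.mem_neLocus.1 hj, fun i hji => by
    by_contra hi
    exact (hmax i (Finsupp.mem_neLocus.2 hi)).not_gt hji⟩

theorem integral_multipleLaguerre_mul_eq_zero (hθ : 0 < θ)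
    (hY : IsPoissonProcess P (gammaIntensity θ) Y) (hπ : IsSizeBiasedOrder P Y π) {m m' : ℕ}
    {n n' : ℕ →₀ ℕ} (hne : (m, n) ≠ (m', n')) :
    ∫ y, multipleLaguerre θ m n y * multipleLaguerre θ m' n' y ∂(P.map fun ω k => Y (π k ω) ω)
      = 0 := by
  obtain ⟨K, hK⟩ := (n.support ∪ n'.support).exists_nat_subset_range
  obtain ⟨hK₁, hK₂⟩ := Finset.union_subset_iff.1 hK
  rw [(integrable_and_integral_multipleLaguerre_mul hθ hY hπ m m' hK₁ hK₂).2]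
  by_cases hn : n = n'
  · subst hn
    rw [integral_radialPoly_mul hθ n fun h => hne (by rw [h]), zero_mul]
  · obtain ⟨j, hj, htail⟩ := exists_ne_and_forall_lt_eq hn
    have hjK : j ∈ Finset.range K := hK (by
      simp only [Finset.mem_union, Finsupp.mem_support_iff]
      omega)
    rw [Finset.prod_eq_zero hjK (integral_stickPoly_mul hθ hj htail), mul_zero]

theorem isOrthogonalSystem_multipleLaguerre (hθ : 0 < θ)
    (hY : IsPoissonProcess P (gammaIntensity θ) Y) (hπ : IsSizeBiasedOrder P Y π) :
    IsOrthogonalSystem (P.map fun ω k => Y (π k ω) ω)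
      (fun i : ℕ × (ℕ →₀ ℕ) => multipleLaguerre θ i.1 i.2) where
  memLp := by
    rintro ⟨m, n⟩
    obtain ⟨K, hK⟩ := n.support.exists_nat_subset_range
    rw [memLp_two_iff_integrable_sq (measurable_multipleLaguerre θ m n).aestronglyMeasurable]
    simpa only [sq] using
      (integrable_and_integral_multipleLaguerre_mul hθ hY hπ m m hK hK).1
  orthogonal := fun _ _ hne => integral_multipleLaguerre_mul_eq_zero hθ hY hπ hne
  norm_pos := by
    rintro ⟨m, n⟩
    obtain ⟨K, hK⟩ := n.support.exists_nat_subset_range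
    have := isProbabilityMeasure_gammaMeasure hθ one_pos
    have := isProbabilityMeasureBeta one_pos hθ
    have hradial := integrable_eval_gammaMeasure hθ one_pos (radialPoly θ m n * radialPoly θ m n)
    simp only [eval_mul] at hradial
    simp only [sq, (integrable_and_integral_multipleLaguerre_mul hθ hY hπ m m hK hK).2]
    exact mul_pos (integral_eval_mul_self_pos (radialPoly_ne_zero hθ m n) hradial)
      (Finset.prod_pos fun j _ => integral_eval_mul_self_pos (stickPoly_ne_zero hθ n j)
        (integrable_betaMeasure_of_continuous one_pos hθ (by fun_prop)))

end SizeBiased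

/-! ### Polynomials in the sum and the coordinates of a sequence -/

/-- The linear form `|y| - ∑_{i < j} y_i` in the variables `|y|` (encoded as `none`) and `y_i`
(encoded as `some i`), as in `IsPolynomialOfDegree`. -/
def remainderForm (j : ℕ) : MvPolynomial (Option ℕ) ℝ :=
  MvPolynomial.X none - ∑ i ∈ Finset.range j, MvPolynomial.X (some i)

/-- The homogenization of degree `d` of the Jacobi polynomial `R_d^{(α, β)}` evaluated at the `j`-th
stick `y_j / (|y| - ∑_{i < j} y_i)`, with the denominator as homogenizing variable. -/
def homJacobi (α β : ℝ) (d j : ℕ) : MvPolynomial (Option ℕ) ℝ :=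
  ∑ k ∈ Finset.range (d + 1), MvPolynomial.C (jacobiCoeff α β d k) *
    (remainderForm (j + 1) ^ k * remainderForm j ^ (d - k))

lemma isHomogeneous_remainderForm (j : ℕ) : (remainderForm j).IsHomogeneous 1 :=
  (MvPolynomial.isHomogeneous_X ℝ none).sub
    (MvPolynomial.IsHomogeneous.sum _ _ _ fun i _ => MvPolynomial.isHomogeneous_X ℝ (some i))

lemma eval_remainderForm (z : Option ℕ → ℝ) (j : ℕ) :
    MvPolynomial.eval z (remainderForm j) = z none - ∑ i ∈ Finset.range j, z (some i) := by
  simp only [remainderForm, map_sub, map_sum, MvPolynomial.eval_X]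

lemma isHomogeneous_homJacobi (α β : ℝ) (d j : ℕ) : (homJacobi α β d j).IsHomogeneous d := by
  refine MvPolynomial.IsHomogeneous.sum _ _ _ fun k hk => ?_
  have h := (MvPolynomial.isHomogeneous_C (Option ℕ) (jacobiCoeff α β d k)).mul
    (((isHomogeneous_remainderForm (j + 1)).pow k).mul
      ((isHomogeneous_remainderForm j).pow (d - k)))
  have hdeg : 0 + (1 * k + 1 * (d - k)) = d := by
    have := Finset.mem_range.1 hk
    omega
  rwa [hdeg] at h

lemma eval_homJacobi (α : ℝ) {β : ℝ} (hβ : 0 < β) (d : ℕ) {j : ℕ} {s : ℝ} {y : ℕ → ℝ}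
    (hrem : s - ∑ i ∈ Finset.range j, y i ≠ 0) :
    MvPolynomial.eval (fun o => o.elim s y) (homJacobi α β d j)
      = (shiftedJacobi α β d).eval (stick s y j) * (s - ∑ i ∈ Finset.range j, y i) ^ d := by
  simp_rw [homJacobi, map_sum, eval_shiftedJacobi α hβ, Finset.sum_mul, map_mul, map_pow,
    eval_remainderForm, MvPolynomial.eval_C, Option.elim, stick, Nat.Iio_eq_range,
    one_sub_div hrem, Finset.sum_range_succ y, sub_add_eq_sub_sub]
  refine Finset.sum_congr rfl fun k hk => ?_
  rw [mul_assoc, div_pow, div_mul_eq_mul_div, mul_div_assoc,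
    pow_sub₀ _ hrem (Nat.lt_succ_iff.1 (Finset.mem_range.1 hk)), ← div_eq_mul_inv]

lemma homJacobi_ne_zero (α : ℝ) {β : ℝ} (hβ : 0 < β) (d j : ℕ) : homJacobi α β d j ≠ 0 := by
  intro h
  have hval := eval_homJacobi α hβ d (j := j) (s := 1) (y := Pi.single j 1)
    (by simp [Pi.single_apply])
  simp [h, stick, Pi.single_apply, eval_one_shiftedJacobi α hβ] at hval

lemma totalDegree_toMvPolynomial {R σ : Type*} [CommSemiring R] (o : σ) (p : R[X]) :
    (p.toMvPolynomial o).totalDegree = p.natDegree := by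
  classical
  have hsum : p.toMvPolynomial o = ∑ k ∈ Finset.range (p.natDegree + 1),
      MvPolynomial.monomial (Finsupp.single o k) (p.coeff k) := by
    simp_rw [toMvPolynomial, aeval_eq_sum_range, MvPolynomial.smul_eq_C_mul,
      MvPolynomial.C_mul_X_pow_eq_monomial]
  refine le_antisymm ?_ ?_
  · rw [hsum]
    refine MvPolynomial.totalDegree_finsetSum_le fun k hk =>
      (MvPolynomial.totalDegree_monomial_le _ _).trans ?_
    rw [Finsupp.sum_single_index rfl]
    exact Nat.lt_succ_iff.1 (Finset.mem_range.1 hk)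
  · rcases eq_or_ne p 0 with rfl | hp
    · simp
    have hcoeff : (p.toMvPolynomial o).coeff (Finsupp.single o p.natDegree) = p.leadingCoeff := by
      simp [hsum, MvPolynomial.coeff_sum, MvPolynomial.coeff_monomial,
        (Finsupp.single_injective o).eq_iff]
    have hmem : Finsupp.single o p.natDegree ∈ (p.toMvPolynomial o).support := by
      rw [MvPolynomial.mem_support_iff, hcoeff]
      exact leadingCoeff_ne_zero.2 hp
    simpa only [Finsupp.sum_single_index] using MvPolynomial.le_totalDegree hmem

/-! ### The multiple Laguerre polynomials are polynomials -/

lemma pow_degree_mul_gemPoly_div {s : ℝ} (hs : s ≠ 0) (θ : ℝ) (n : ℕ →₀ ℕ) (y : ℕ → ℝ) :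
    s ^ n.degree * gemPoly θ n (fun j => y j / s) = ∏ j ∈ n.support,
      (shiftedJacobi 1 (θ + 2 * tailDegree n j) (n j)).eval (stick s y j) *
        (s - ∑ i ∈ Finset.range j, y i) ^ n j := by
  have hdegree : n.degree = ∑ j ∈ n.support, n j := rfl
  rw [gemPoly_div hs, hdegree, ← Finset.prod_pow_eq_pow_sum, ← Finset.prod_mul_distrib]
  refine Finset.prod_congr rfl fun j _ => ?_
  rw [mul_left_comm, ← mul_pow, mul_div_cancel₀ _ hs]

lemma sub_sum_range_pos {y : ℕ → ℝ} (hpos : ∀ i, 0 < y i) (hsum : Summable y) (j : ℕ) :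
    0 < ∑' i, y i - ∑ i ∈ Finset.range j, y i := by
  have hle := hsum.sum_le_tsum (Finset.range (j + 1)) fun i _ => (hpos i).le
  rw [Finset.sum_range_succ] at hle
  linarith [hpos j]

theorem isPolynomialOfDegree_multipleLaguerre {θ : ℝ} (hθ : 0 < θ) (m : ℕ) (n : ℕ →₀ ℕ) :
    IsPolynomialOfDegree (multipleLaguerre θ m n) (m + n.degree) := by
  have ha : 0 < θ + 2 * (n.degree : ℝ) := by positivity
  have hβ (j) : 0 < θ + 2 * (tailDegree n j : ℝ) := by positivity
  set p := (laguerre (θ + 2 * n.degree) m).toMvPolynomial (none : Option ℕ) with hp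
  set q := ∏ j ∈ n.support, homJacobi 1 (θ + 2 * tailDegree n j) (n j) j with hq
  have hp0 : p ≠ 0 :=
    (map_ne_zero_iff _ (toMvPolynomial_injective none)).2 (laguerre_ne_zero ha m)
  have hq0 : q ≠ 0 := Finset.prod_ne_zero_iff.2 fun j _ => homJacobi_ne_zero 1 (hβ j) _ _
  have hqdeg : q.totalDegree = n.degree :=
    (MvPolynomial.IsHomogeneous.prod _ _ _ fun j _ =>
      isHomogeneous_homJacobi _ _ _ _).totalDegree hq0
  refine ⟨p * q, ?_, fun y hpos hsum => ?_⟩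
  · rw [MvPolynomial.totalDegree_mul_of_isDomain hp0 hq0, hqdeg, totalDegree_toMvPolynomial,
      natDegree_laguerre ha]
  · have hrem := sub_sum_range_pos hpos hsum
    have hs : ∑' i, y i ≠ 0 := by simpa using (hrem 0).ne'
    rw [multipleLaguerre, mul_assoc, pow_degree_mul_gemPoly_div hs, map_mul, hp,
      MvPolynomial.eval_toMvPolynomial, hq, map_prod]
    simp_rw [eval_homJacobi 1 (hβ _) _ (hrem _).ne', Option.elim]

end

end GammaLaguerre

theorem corollary4p5 {Ω : Type*} [MeasurableSpace Ω] (P : Measure Ω) [IsProbabilityMeasure P]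
    (θ : ℝ) (hθ : 0 < θ) (Y : ℕ → Ω → ℝ) (π : ℕ → Ω → ℕ)
    (hY : GammaLaguerre.IsPoissonProcess P (GammaLaguerre.gammaIntensity θ) Y)
    (hπ : GammaLaguerre.IsSizeBiasedOrder P Y π) :
    (∀ (m : ℕ) (n : ℕ →₀ ℕ),
      GammaLaguerre.IsPolynomialOfDegree (GammaLaguerre.multipleLaguerre θ m n) (m + n.degree)) ∧
    GammaLaguerre.IsOrthogonalSystem (P.map (fun ω k => Y (π k ω) ω))
      (fun i : ℕ × (ℕ →₀ ℕ) => GammaLaguerre.multipleLaguerre θ i.1 i.2) :=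
  ⟨fun m n => GammaLaguerre.isPolynomialOfDegree_multipleLaguerre hθ m n,
    GammaLaguerre.isOrthogonalSystem_multipleLaguerre hθ hY hπ⟩
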